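/- **Network.** Let $\lambda_1,\lambda_2,\lambda_u,P_1,P_2,P_u,\sigma^2>0$ and $\alpha>2$; write $\bar k$ for the tier other than $k\in\{1,2\}$. Base stations (BSs) of tier $k$ form independent homogeneous Poisson point processes in the plane of densities $\lambda_k$; $D_k$ is the distance from the typical user (at the origin) to the closest BS of tier $k$. The user is in tier $k$ if $P_kD_k^{-\alpha}\ge P_{\bar k}D_{\bar k}^{-\alpha}$, with probability $\mathcal A_k$. Given thresholds $\gamma_1,\gamma_2\in[0,\infty]$, a user in tier $k$ is full-duplex (FD) if $P_kD_k^{-\alpha}\ge\gamma_k$ and half-duplex (HD) otherwise, with probabilities $\mathcal A_k^{\rm FD},\mathcal A_k^{\rm HD}$; $D_k^{\rm FD},D_k^{\rm HD}$ are distributed as $D_k$ given these events. Put $\lambda_t^{\bullet}=\lambda_t\mathcal A_t^{\bullet}/\mathcal A_t$ ($\bullet\in\{{\rm FD},{\rm HD}\}$), $\delta_t=(P_t/\gamma_t)^{1/\alpha}\in[0,\infty]$, $\mu_k(r)=r(P_{\bar k}/P_k)^{1/\alpha}$, $\Delta_{k,t}(r)=r(P_t/P_k)^{1/\alpha}$.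 **Interference model.** Conditionally on the distance $r$ between the typical user of tier $k$ and its BS (the tagged BS), the interfering FD/HD-scheduling BSs $\Phi_t^{\bullet}$ and the interfering FD/HD users $\Phi_{u,t}^{\bullet}$ of tier $t$ are independent Poisson processes. Let $y$ be the distance to the receiver (the typical user in the downlink D, the tagged BS in the uplink U), and let $x=r+y$ (D), $x=y$ (U), $\zeta=x/\max\{(P_k/P_t)^{1/\alpha}-1,0\}\in[0,\infty]$. The intensity functions are * $\Phi_t^{\rm FD}$: $\lambda_{k,t}^{\rm BS,FD}(y)=\lambda_t^{\rm FD}(1-e^{-\lambda_u\pi\zeta^2})$; * $\Phi_t^{\rm HD}$: $\lambda_t^{\rm HD}(1-e^{-\lambda_u\pi(\zeta^2-\delta_t^2)})$ if $\zeta>\delta_t$, and $0$ otherwise; * $\Phi_{u,t}^{\bullet}$: $\lambda_t^{\bullet}(1-e^{-\pi x^2\lambda_t(P_t/P_k)^{2/\alpha}})$. They are restricted to the following regions. In D: $y\ge\Delta_{k,t}(r)$ for BSs, $y\ge\max\{\Delta_{k,t}(r)-\delta_t,0\}$ for FD users, $y\ge\max\{\delta_t(P_k/P_t)^{1/\alpha}-r,0\}$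 for HD users. In U: for BSs, the plane without a sector centred at the tagged BS with radius $\Delta_{k,t}(r)+r$ and area $\pi\Delta_{k,t}(r)^2$ (so that a fraction $p^I_{k,t}=1-\big(P_t^{1/\alpha}/(P_t^{1/\alpha}+P_k^{1/\alpha})\big)^2$ of the disk of that radius remains); $y\ge\max\{((P_t/P_k)^{1/\alpha}-1)r-\delta_t,0\}$ for FD users; $y\ge\delta_t(P_k/P_t)^{1/\alpha}$ for HD users. A node at distance $y$ contributes the interference $P\,h\,y^{-\alpha}$, with $P=P_t$ for BSs and $P=P_u$ for users. All fading coefficients $h$, including that of the useful signal, are i.i.d. exponential of mean $1$, independent of the node locations. Channel 1 is interfered by $\Phi_t^{\rm FD},\Phi_{u,t}^{\rm FD},\Phi_t^{\rm HD}$ and channel 2 by $\Phi_t^{\rm FD},\Phi_{u,t}^{\rm FD},\Phi_{u,t}^{\rm HD}$, $t=1,2$. On channel $i$ the SINRs are $$\theta_k^{i,{\rm FD,D}}=\frac{P_kh(D_k^{\rm FD})^{-\alpha}}{RSI_u+I+\sigma^2},\qquad \theta_k^{i,{\rm FD,U}}=\frac{P_uh(D_k^{\rm FD})^{-\alpha}}{RSI_k+I+\sigma^2},$$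 with $I$ the total interference at the receiver and $RSI_u,RSI_k\ge0$ the residual self-interference of the users and of the BSs of tier $k$. $\theta_k^{1,{\rm HD}}$ (downlink) and $\theta_k^{2,{\rm HD}}$ (uplink) are defined likewise with $D_k^{\rm HD}$ and without RSI. Let $S_k^{\ast}=\tfrac12\mathbb E[\log_2(1+\theta_k^{\ast})]$ and $$S=\sum_{i=1,2}\sum_{k=1,2}\Big(\mathcal A_k^{\rm FD}(S_k^{i,{\rm FD,D}}+S_k^{i,{\rm FD,U}})+\mathcal A_k^{\rm HD}S_k^{i,{\rm HD}}\Big),\qquad S^{\rm D}=\sum_{k=1,2}\Big(\mathcal A_k^{\rm FD}\sum_{i=1,2}S_k^{i,{\rm FD,D}}+\mathcal A_k^{\rm HD}S_k^{1,{\rm HD}}\Big).$$ **Claim.** Consider the full-duplex network $\gamma_1=\gamma_2=0$ with perfect self-interference cancellation ($RSI_1=RSI_2=RSI_u=0$) and with the interference from full-duplex users neglected (the terms of $\Phi_{u,t}^{\rm FD}$ are dropped from $I$); let $\widetilde\theta_k^{i,{\rm FD},d}$, $d\in\{{\rm D,U}\}$, be the resulting SINRs. Then, for $i,k\in\{1,2\}$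 and all $T\ge0$, $\mathbb P(\widetilde\theta_k^{i,{\rm FD},d}>T)=\widetilde{\mathcal C}_k^{d}(T)$, where, with $p_{\rm D}=P_k$ and $p_{\rm U}=P_u$, $$\widetilde{\mathcal C}_k^{d}(T)=\frac{2\pi\lambda_k}{\mathcal A_k}\int_0^\infty \exp\Big(-\frac{T\sigma^2r^{\alpha}}{p_d}\Big)\,r\,e^{-\pi\lambda_kr^2-\pi\lambda_{\bar k}\mu_k(r)^2}\prod_{t=1,2}\mathcal L_{t}^{d}(r,T)\,dr .$$ Here, with $g_d(y)=\lambda_{k,t}^{\rm BS,FD}(y)\,y\,\big(1-\big(1+\tfrac{P_tTr^\alpha}{p_d\,y^\alpha}\big)^{-1}\big)$ taken at $\gamma=0$ in direction $d$, $$\mathcal L_t^{\rm D}=\exp\Big(-2\pi\int_{\Delta_{k,t}(r)}^\infty g_{\rm D}(y)\,dy\Big),\qquad \mathcal L_t^{\rm U}=\exp\Big(-2\pi p^I_{k,t}\int_0^{\Delta_{k,t}(r)+r}g_{\rm U}(y)\,dy-2\pi\int_{\Delta_{k,t}(r)+r}^\infty g_{\rm U}(y)\,dy\Big).$$ The expectations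 $\mathbb E[\log_2(1+\widetilde\theta_k^{i,{\rm FD},d})]$ and the integrals below are finite, and the spectral efficiency of this network is $$S=\frac1{\ln2}\sum_{k=1,2}\mathcal A_k\int_0^\infty\frac{\widetilde{\mathcal C}_k^{\rm D}(T)+\widetilde{\mathcal C}_k^{\rm U}(T)}{1+T}\,dT .$$ Moreover its downlink spectral efficiency $S^{\rm D}$ is exactly twice the downlink spectral efficiency $S^{\rm D}$ of the half-duplex network $\gamma_1=\gamma_2=\infty$ (with arbitrary RSI and no interference neglected). -/

import Mathlib

open MeasureTheory ProbabilityTheory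
open scoped ENNReal NNReal

noncomputable section

namespace HetNet

/-! ## Point processes in the plane -/

/-- A (countable) configuration of points in the plane `ℂ`: the number `N ∈ ℕ ∪ {∞}` of points and a
sequence whose entries of index `n < N` are the points. -/
abbrev Config : Type := ℕ∞ × (ℕ → ℂ)

open Classical in
/-- The number of points of a configuration lying in `B`. -/
def Config.count (x : Config) (B : Set ℂ) : ℝ≥0∞ :=
  ∑' n : ℕ, if (n : ℕ∞) < x.1 ∧ x.2 n ∈ B then 1 else 0

open Classical in
/-- The distance from the origin to the closest point of a configuration (`∞` if there is none). -/
def Config.nearest (x : Config) : ℝ≥0∞ :=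
  ⨅ n : ℕ, if (n : ℕ∞) < x.1 then ENNReal.ofReal ‖x.2 n‖ else ⊤

/-- `X` is, under the probability measure `μ`, a Poisson point process with intensity measure `Λ`:
counts of sets of finite intensity are Poisson distributed, and counts of pairwise disjoint sets are
independent. -/
structure IsPoissonProcess {Ω : Type*} [MeasurableSpace Ω] (X : Ω → Config) (Λ : Measure ℂ)
    (μ : Measure Ω) : Prop where
  measurable : Measurable X
  count_law : ∀ B : Set ℂ, MeasurableSet B → Λ B ≠ ⊤ → ∀ n : ℕ,
    μ {ω | (X ω).count B = n} = poissonMeasure (Λ B).toNNReal {n}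
  count_indep : ∀ (m : ℕ) (B : Fin m → Set ℂ), (∀ j, MeasurableSet (B j)) →
    (∀ i j, i ≠ j → Disjoint (B i) (B j)) →
    iIndepFun (fun j ω => (X ω).count (B j)) μ

/-! ## The two-tier network

Tiers are indexed by `Fin 2` (`0` macro cells, `1` small cells); `k.rev` is the other tier.
Channels are indexed by `Fin 2` (`0` the downlink channel, `1` the uplink channel). -/

/-- The parameters of the network. -/
structure Params where
  /-- density of the base stations of each tier -/
  lam : Fin 2 → ℝ
  /-- density of the users -/
  lamU : ℝ
  /-- transmit power of the base stations of each tier -/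
  P : Fin 2 → ℝ
  /-- transmit power of the users -/
  PU : ℝ
  /-- path loss exponent -/
  α : ℝ
  /-- thermal noise power -/
  noise : ℝ
  lam_pos : ∀ k, 0 < lam k
  lamU_pos : 0 < lamU
  P_pos : ∀ k, 0 < P k
  PU_pos : 0 < PU
  two_lt_α : 2 < α
  noise_pos : 0 < noise

/-- The residual self-interference of the base stations of each tier and of the users. -/
structure Residual where
  bs : Fin 2 → ℝ≥0
  user : ℝ≥0

/-- Perfect self-interference cancellation. -/
def Residual.zero : Residual := ⟨fun _ => 0, 0⟩

/-- Direction of a transmission between the typical user and its serving base station. -/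
inductive Dir
  | down
  | up

/-- The four kinds of interfering nodes: base stations scheduling a full-duplex / half-duplex user,
and scheduled full-duplex / half-duplex users. -/
inductive NodeClass
  | bsFD
  | bsHD
  | userFD
  | userHD

/-- The base stations seen by the typical user, who is at the origin: independent homogeneous
Poisson processes of densities `lam 0` and `lam 1`. -/
structure BaseStations (net : Params) (Ω : Type*) [MeasurableSpace Ω] where
  μ : Measure Ω
  isProb : IsProbabilityMeasure μ
  Φ : Fin 2 → Ω → Config
  poisson : ∀ k, IsPoissonProcess (Φ k) (ENNReal.ofReal (net.lam k) • volume) μ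
  indep : IndepFun (Φ 0) (Φ 1) μ

section Association

variable {net : Params} {Ω : Type*} [MeasurableSpace Ω] (B : BaseStations net Ω)

/-- The distance `D_k` from the typical user to its closest base station in tier `k`. -/
def BaseStations.dist (k : Fin 2) (ω : Ω) : ℝ≥0∞ := (B.Φ k ω).nearest

/-- The average received power `P_k D_k ^ (-α)`. -/
def BaseStations.power (k : Fin 2) (ω : Ω) : ℝ≥0∞ :=
  ENNReal.ofReal (net.P k) * B.dist k ω ^ (-net.α)

/-- The typical user is associated with tier `k`. -/
def BaseStations.inTier (k : Fin 2) : Set Ω := {ω | B.power k.rev ω ≤ B.power k ω}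

/-- The typical user is a full-duplex user of tier `k`, for the received power thresholds `γ`. -/
def BaseStations.inTierFD (γ : Fin 2 → ℝ≥0∞) (k : Fin 2) : Set Ω :=
  {ω | ω ∈ B.inTier k ∧ γ k ≤ B.power k ω}

/-- The typical user is a half-duplex user of tier `k`, for the received power thresholds `γ`. -/
def BaseStations.inTierHD (γ : Fin 2 → ℝ≥0∞) (k : Fin 2) : Set Ω :=
  {ω | ω ∈ B.inTier k ∧ B.power k ω < γ k}

/-- The association probability `A_k`. -/
def BaseStations.A (k : Fin 2) : ℝ := B.μ.real (B.inTier k)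

/-- The association probability `A_k^FD`. -/
def BaseStations.AFD (γ : Fin 2 → ℝ≥0∞) (k : Fin 2) : ℝ := B.μ.real (B.inTierFD γ k)

/-- The association probability `A_k^HD`. -/
def BaseStations.AHD (γ : Fin 2 → ℝ≥0∞) (k : Fin 2) : ℝ := B.μ.real (B.inTierHD γ k)

/-- The law of the transmit distance `D_k^FD`: the conditional law of `D_k` given that the typical
user is a full-duplex user of tier `k`. -/
def BaseStations.lawFD (γ : Fin 2 → ℝ≥0∞) (k : Fin 2) : Measure ℝ :=
  (B.μ[|B.inTierFD γ k]).map (fun ω => (B.dist k ω).toReal)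

/-- The law of the transmit distance `D_k^HD`. -/
def BaseStations.lawHD (γ : Fin 2 → ℝ≥0∞) (k : Fin 2) : Measure ℝ :=
  (B.μ[|B.inTierHD γ k]).map (fun ω => (B.dist k ω).toReal)

/-- `λ_t^FD = (A_t^FD / A_t) λ_t`. -/
def BaseStations.lamFD (γ : Fin 2 → ℝ≥0∞) (t : Fin 2) : ℝ := B.AFD γ t / B.A t * net.lam t

/-- `λ_t^HD = (A_t^HD / A_t) λ_t`. -/
def BaseStations.lamHD (γ : Fin 2 → ℝ≥0∞) (t : Fin 2) : ℝ := B.AHD γ t / B.A t * net.lam t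

end Association

/-! ## Intensity functions of the interfering nodes -/

/-- `δ_t = (P_t / γ_t) ^ (1/α)`, which is `∞` for `γ_t = 0` and `0` for `γ_t = ∞`. -/
def Params.δ (net : Params) (γ : Fin 2 → ℝ≥0∞) (t : Fin 2) : ℝ≥0∞ :=
  (ENNReal.ofReal (net.P t) / γ t) ^ (1 / net.α)

/-- `(P_t / P_k) ^ (1/α)`. -/
def Params.ratio (net : Params) (t k : Fin 2) : ℝ := (net.P t / net.P k) ^ (1 / net.α)

/-- `Δ_{k,t}(r) = r (P_t / P_k) ^ (1/α)`. -/
def Params.Δ (net : Params) (k t : Fin 2) (r : ℝ) : ℝ := r * net.ratio t k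

/-- `μ_k(r) = r (P_{k̄} / P_k) ^ (1/α)`. -/
def Params.mu (net : Params) (k : Fin 2) (r : ℝ) : ℝ := r * net.ratio k.rev k

/-- The radius `ζ` of the coverage area of an interfering base station of tier `t` at distance `y`
from the receiver, `∞` where the denominator vanishes. -/
def Params.ζ (net : Params) (k : Fin 2) (d : Dir) (t : Fin 2) (r y : ℝ) : ℝ≥0∞ :=
  (match d with
    | .down => ENNReal.ofReal (r + y)
    | .up => ENNReal.ofReal y) / ENNReal.ofReal (max (net.ratio k t - 1) 0)

/-- `1 - exp (-x)`, the probability that a Poisson variable of mean `x ∈ [0, ∞]` is not `0`. -/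
def activeProb (x : ℝ≥0∞) : ℝ := if x = ⊤ then 1 else 1 - Real.exp (-x.toReal)

/-- The ratio of the area where base stations of tier `t` interfere with the tagged base station
to the area of the disk of radius `Δ_{k,t}(r) + r`. -/
def Params.pI (net : Params) (k t : Fin 2) : ℝ :=
  1 - (net.P t ^ (1 / net.α) / (net.P t ^ (1 / net.α) + net.P k ^ (1 / net.α))) ^ 2

section Intensity

variable {net : Params} {Ω : Type*} [MeasurableSpace Ω] (B : BaseStations net Ω)

open Classical in
/-- The intensity functions: density of the interfering nodes of class `c` and tier `t` at distance
`y` from the receiver, if the typical user is in tier `k`, at distance `r` from the tagged base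
station. The receiver is the typical user for `d = down`, the tagged base station for `d = up`. -/
def BaseStations.intensityFun (γ : Fin 2 → ℝ≥0∞) (k : Fin 2) (d : Dir) (c : NodeClass) (t : Fin 2)
    (r y : ℝ) : ℝ :=
  match c with
  | .bsFD =>
      B.lamFD γ t * activeProb (ENNReal.ofReal (net.lamU * Real.pi) * net.ζ k d t r y ^ 2)
  | .bsHD =>
      if net.ζ k d t r y ≤ net.δ γ t then 0
      else B.lamHD γ t * activeProb
        (ENNReal.ofReal (net.lamU * Real.pi) * (net.ζ k d t r y ^ 2 - net.δ γ t ^ 2))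
  | .userFD =>
      B.lamFD γ t * (1 - Real.exp (-Real.pi * (match d with | .down => r + y | .up => y) ^ 2 *
        net.lam t * (net.P t / net.P k) ^ (2 / net.α)))
  | .userHD =>
      B.lamHD γ t * (1 - Real.exp (-Real.pi * (match d with | .down => r + y | .up => y) ^ 2 *
        net.lam t * (net.P t / net.P k) ^ (2 / net.α)))

/-- The region of the plane, centred at the receiver, that the association and duplexing rules
leave to the interfering nodes. In the uplink, no interfering base station lies in a sector of
radius `Δ_{k,t}(r) + r` with the same area as the disk of radius `Δ_{k,t}(r)`. Truncated subtraction
in `ℝ≥0∞` yields the maxima with `0`. -/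
def Params.region (net : Params) (γ : Fin 2 → ℝ≥0∞) (k : Fin 2) (d : Dir) (c : NodeClass)
    (t : Fin 2) (r : ℝ) : Set ℂ :=
  match d, c with
  | .down, .bsFD => {z | net.Δ k t r ≤ ‖z‖}
  | .down, .bsHD => {z | net.Δ k t r ≤ ‖z‖}
  | .down, .userFD => {z | ENNReal.ofReal (net.Δ k t r) - net.δ γ t ≤ ENNReal.ofReal ‖z‖}
  | .down, .userHD =>
      {z | net.δ γ t * ENNReal.ofReal (net.ratio k t) - ENNReal.ofReal r ≤ ENNReal.ofReal ‖z‖}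
  | .up, .bsFD => {z | ‖z‖ < net.Δ k t r + r ∧ |z.arg| ≤ Real.pi * (1 - net.pI k t)}ᶜ
  | .up, .bsHD => {z | ‖z‖ < net.Δ k t r + r ∧ |z.arg| ≤ Real.pi * (1 - net.pI k t)}ᶜ
  | .up, .userFD =>
      {z | ENNReal.ofReal ((net.ratio t k - 1) * r) - net.δ γ t ≤ ENNReal.ofReal ‖z‖}
  | .up, .userHD => {z | net.δ γ t * ENNReal.ofReal (net.ratio k t) ≤ ENNReal.ofReal ‖z‖}

/-- The intensity measures of the interfering processes. -/
def BaseStations.intensity (γ : Fin 2 → ℝ≥0∞) (k : Fin 2) (d : Dir) (c : NodeClass) (t : Fin 2)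
    (r : ℝ) : Measure ℂ :=
  (volume.restrict (net.region γ k d c t r)).withDensity
    (fun z => ENNReal.ofReal (B.intensityFun γ k d c t r ‖z‖))

/-! ## Links, interference, SINR -/

/-- The random environment of a link of the typical user in tier `k`, in direction `d`: conditioned
on the distance `r` between the typical user and the tagged base station (that is, under `κ r`), the
interfering nodes of each class and tier, in coordinates centred at the receiver, form independent
Poisson processes with the intensity measures above. The small-scale fading coefficients of the
useful signal (`fade none`) and of the interfering nodes (`fade (some (c, t, n))` for the `n`-th
node of class `c` and tier `t`) are i.i.d. exponential of mean `1` and independent of the nodes. -/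
structure Link (γ : Fin 2 → ℝ≥0∞) (k : Fin 2) (d : Dir) (Ω' : Type*) [MeasurableSpace Ω'] where
  κ : Kernel ℝ Ω'
  markov : IsMarkovKernel κ
  nodes : NodeClass × Fin 2 → Ω' → Config
  fade : Option (NodeClass × Fin 2 × ℕ) → Ω' → ℝ
  fade_measurable : ∀ s, Measurable (fade s)
  nodes_poisson : ∀ r : ℝ, 0 < r → ∀ c t,
    IsPoissonProcess (nodes (c, t)) (B.intensity γ k d c t r) (κ r)
  nodes_indep : ∀ r : ℝ, 0 < r → iIndepFun nodes (κ r)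
  fade_law : ∀ r : ℝ, 0 < r → ∀ s, (κ r).map (fade s) = expMeasure 1
  fade_indep : ∀ r : ℝ, 0 < r → iIndepFun fade (κ r)
  fade_nodes_indep : ∀ r : ℝ, 0 < r →
    IndepFun (fun ω s => fade s ω) (fun ω s => nodes s ω) (κ r)

end Intensity

/-- Transmit power of an interfering node. -/
def Params.txPower (net : Params) (c : NodeClass) (t : Fin 2) : ℝ :=
  match c with
  | .bsFD => net.P t
  | .bsHD => net.P t
  | .userFD => net.PU
  | .userHD => net.PU

section Link

variable {net : Params} {Ω : Type*} [MeasurableSpace Ω] {B : BaseStations net Ω}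
  {γ : Fin 2 → ℝ≥0∞} {k : Fin 2} {d : Dir} {Ω' : Type*} [MeasurableSpace Ω']
  (L : Link B γ k d Ω')

open Classical in
/-- The interference caused at the receiver by the nodes of class `c` and tier `t`. -/
def Link.classInterference (c : NodeClass) (t : Fin 2) (ω : Ω') : ℝ≥0∞ :=
  ∑' n : ℕ, if (n : ℕ∞) < (L.nodes (c, t) ω).1 then
      ENNReal.ofReal (net.txPower c t) * ENNReal.ofReal (L.fade (some (c, t, n)) ω) *
        ENNReal.ofReal ‖(L.nodes (c, t) ω).2 n‖ ^ (-net.α)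
    else 0

/-- The cumulative interference on channel `i` from tier `t`. If `userFD` is `false`, the
interference from full-duplex users is neglected. -/
def Link.interference (userFD : Bool) (i t : Fin 2) (ω : Ω') : ℝ≥0∞ :=
  L.classInterference .bsFD t ω + (if userFD then L.classInterference .userFD t ω else 0) +
    (if i = 0 then L.classInterference .bsHD t ω else L.classInterference .userHD t ω)

/-- The SINR on channel `i` of a link of length `r`, with residual self-interference `ρ`. -/
def Link.sinr (userFD : Bool) (ρ : ℝ≥0) (i : Fin 2) (r : ℝ) (ω : Ω') : ℝ :=
  (ENNReal.ofReal ((match d with | .down => net.P k | .up => net.PU) * L.fade none ω *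
      r ^ (-net.α)) /
    (ρ + ∑ t, L.interference userFD i t ω + ENNReal.ofReal net.noise)).toReal

/-- The SINR `θ_k^{i,FD,d}`, as a function of the distance and the environment. -/
def Link.sinrFD (userFD : Bool) (ρ : Residual) (i : Fin 2) (p : ℝ × Ω') : ℝ :=
  L.sinr userFD (match d with | .down => ρ.user | .up => ρ.bs k) i p.1 p.2

/-- The SINR `θ_k^{i,HD}`, as a function of the distance and the environment. -/
def Link.sinrHD (userFD : Bool) (i : Fin 2) (p : ℝ × Ω') : ℝ :=
  L.sinr userFD 0 i p.1 p.2

/-- The joint law of the distance `D_k^FD` and the environment. -/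
def Link.jointFD : Measure (ℝ × Ω') := (B.lawFD γ k).compProd L.κ

/-- The joint law of the distance `D_k^HD` and the environment. -/
def Link.jointHD : Measure (ℝ × Ω') := (B.lawHD γ k).compProd L.κ

/-- The SINR distribution `C_k^{i,FD,d}(T) = ℙ(θ_k^{i,FD,d} > T)`. -/
def Link.distFD (userFD : Bool) (ρ : Residual) (i : Fin 2) (T : ℝ) : ℝ :=
  L.jointFD.real {p | T < L.sinrFD userFD ρ i p}

/-- The spectral efficiency `S_k^{i,FD,d}`. -/
def Link.SFD (userFD : Bool) (ρ : Residual) (i : Fin 2) : ℝ :=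
  1 / 2 * ∫ p, Real.logb 2 (1 + L.sinrFD userFD ρ i p) ∂L.jointFD

/-- The spectral efficiency `S_k^{i,HD}`. -/
def Link.SHD (userFD : Bool) (i : Fin 2) : ℝ :=
  1 / 2 * ∫ p, Real.logb 2 (1 + L.sinrHD userFD i p) ∂L.jointHD

end Link

/-! ## Spectral efficiency of the network -/

section Efficiency

variable {net : Params} {Ω : Type*} [MeasurableSpace Ω] {B : BaseStations net Ω}
  {γ : Fin 2 → ℝ≥0∞} {Ω' : Type*} [MeasurableSpace Ω'] (L : ∀ k d, Link B γ k d Ω')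

/-- The direction of a half-duplex transmission on channel `i`. -/
def hdDir (i : Fin 2) : Dir := if i = 0 then .down else .up

/-- The spectral efficiency `S` of the typical user. -/
def spectralEfficiency (userFD : Bool) (ρ : Residual) : ℝ :=
  ∑ i, ∑ k, (B.AFD γ k * ((L k .down).SFD userFD ρ i + (L k .up).SFD userFD ρ i) +
    B.AHD γ k * (L k (hdDir i)).SHD userFD i)

/-- The downlink spectral efficiency `S^D` of the typical user. -/
def downlinkSpectralEfficiency (userFD : Bool) (ρ : Residual) : ℝ :=
  ∑ k, (B.AFD γ k * ∑ i, (L k .down).SFD userFD ρ i + B.AHD γ k * (L k .down).SHD userFD 0)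

end Efficiency

/-! ## The closed forms of the approximated full-duplex SINR distributions -/

/-- The Laplace transform of the exponential law of mean `1`. -/
def laplaceExp (s : ℝ) : ℝ := 1 / (1 + s)

/-- Signal-to-noise ratio at distance `r` for transmit power `p`. -/
def Params.snr (net : Params) (p r : ℝ) : ℝ := p * r ^ (-net.α) / net.noise

/-- `F(r) = r exp (-π λ_k r² - π λ_{k̄} μ_k(r)²)`. -/
def Params.F (net : Params) (k : Fin 2) (r : ℝ) : ℝ :=
  r * Real.exp (-Real.pi * net.lam k * r ^ 2 - Real.pi * net.lam k.rev * net.mu k r ^ 2)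

section ClosedForm

variable {net : Params} {Ω : Type*} [MeasurableSpace Ω] (B : BaseStations net Ω)

/-- The factor `L_{Φ_t^FD}(r, T)` at the thresholds `γ = 0`, in direction `d`. -/
def BaseStations.laplaceBS (k : Fin 2) (d : Dir) (t : Fin 2) (r T : ℝ) : ℝ :=
  match d with
  | .down => Real.exp (-2 * Real.pi * ∫ y in Set.Ioi (net.Δ k t r),
      B.intensityFun 0 k .down .bsFD t r y * y *
        (1 - laplaceExp (net.P t * T * r ^ net.α / (net.P k * y ^ net.α))))
  | .up => Real.exp
      (-2 * Real.pi * net.pI k t * (∫ y in Set.Ioc 0 (net.Δ k t r + r),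
          B.intensityFun 0 k .up .bsFD t r y * y *
            (1 - laplaceExp (net.P t * T * r ^ net.α / (net.PU * y ^ net.α))))
        - 2 * Real.pi * ∫ y in Set.Ioi (net.Δ k t r + r),
          B.intensityFun 0 k .up .bsFD t r y * y *
            (1 - laplaceExp (net.P t * T * r ^ net.α / (net.PU * y ^ net.α))))

/-- The approximated full-duplex SINR distribution in closed form, at `γ = 0`, in direction `d`. -/
def BaseStations.approxC (k : Fin 2) (d : Dir) (T : ℝ) : ℝ :=
  2 * Real.pi * net.lam k / B.A k * ∫ r in Set.Ioi (0 : ℝ),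
    Real.exp (-T / net.snr (match d with | .down => net.P k | .up => net.PU) r) * net.F k r *
      ∏ t, B.laplaceBS k d t r T

end ClosedForm

end HetNet

end

noncomputable section

namespace HetNet

open Filter Topology

/-! Fix the link length `r` and put `s = T r ^ α / p`, with `p` the power of the useful signal. The
SINR exceeds `T` exactly when the exponential fading of the signal exceeds `s (I + σ²)`, so its
conditional tail is `exp (-s σ²)` times the Laplace transform of the interference `I` at `s`.
Averaging an interferer over its fading gives `1 / (1 + s P ‖z‖ ^ (-α))`, and the Laplace functional
of a Poisson process turns the product over all nodes into the exponential of `-∫ (1 - 1 / (1 + s P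
‖z‖ ^ (-α)))` against the intensity (`Link.measure_interference_lt`, `Link.measure_lt_sinr`). Polar
coordinates convert this integral into the radial ones of the claim; in the uplink the excluded
sector accounts for the factor `pI`.

At the thresholds `0` no user is half-duplex, so the half-duplex classes have intensity zero and are
almost surely empty. As full-duplex users are neglected, only full-duplex base stations interfere,
identically on both channels. The law of `r` comes from the void probabilities of the two
independent base station processes: the distance to tier `k` has tail `exp (-π λ_k a²)`, and
association to tier `k` means that the other distance is at least `μ_k(r)`
(`BaseStations.map_restrict_inTier`). Integrating over `r` gives the closed form
(`Link.compProd_real_lt_sinr`).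

The layer-cake formula gives `E[log (1 + θ)] = ∫ ℙ(θ > T) / (1 + T) dT`. It is finite because the
noise alone forces the tail to be `O(T ^ (-1/α))` (`BaseStations.exists_approxC_le`). Summing over
two channels absorbs the prefactor `1/2`.

For the factor two, at the thresholds `∞` no user is full-duplex, since received powers are almost
surely finite. In the downlink, half-duplex base stations then have the intensity that full-duplex
ones have at the thresholds `0` (`BaseStations.intensity_bsHD_top`), and the link lengths have the
same law (`BaseStations.lawHD_top`). Hence a half-duplex downlink has the SINR distribution of a
full-duplex one, but is served on one channel instead of two. -/

/-! ## The function `exp (-x)` on `[0, ∞]` -/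

/-- The function `x ↦ exp (-x)` on `[0, ∞]`, which is `0` at `∞`. -/
def expNeg (x : ℝ≥0∞) : ℝ≥0∞ := (EReal.exp x)⁻¹

lemma continuous_expNeg : Continuous expNeg :=
  continuous_inv.comp (ENNReal.continuous_exp.comp continuous_coe_ennreal_ereal)

@[fun_prop]
lemma measurable_expNeg : Measurable expNeg := continuous_expNeg.measurable

@[simp] lemma expNeg_zero : expNeg 0 = 1 := by simp [expNeg]

@[simp] lemma expNeg_top : expNeg ⊤ = 0 := by simp [expNeg]

lemma expNeg_add (x y : ℝ≥0∞) : expNeg (x + y) = expNeg x * expNeg y := by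
  unfold expNeg
  rw [EReal.coe_ennreal_add, EReal.exp_add, ENNReal.mul_inv]
  · left; simp
  · right; simp

lemma antitone_expNeg : Antitone expNeg := fun _ _ h =>
  ENNReal.inv_le_inv.2 (EReal.exp_monotone (EReal.coe_ennreal_le_coe_ennreal_iff.2 h))

lemma expNeg_le_one (x : ℝ≥0∞) : expNeg x ≤ 1 := by
  simpa using antitone_expNeg (zero_le : 0 ≤ x)

lemma expNeg_ofReal {x : ℝ} (hx : 0 ≤ x) :
    expNeg (ENNReal.ofReal x) = ENNReal.ofReal (Real.exp (-x)) := by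
  rw [expNeg, EReal.coe_ennreal_ofReal, max_eq_left hx, EReal.exp_coe, Real.exp_neg,
    ENNReal.ofReal_inv_of_pos (Real.exp_pos _)]

lemma expNeg_sum {ι : Type*} (s : Finset ι) (f : ι → ℝ≥0∞) :
    expNeg (∑ i ∈ s, f i) = ∏ i ∈ s, expNeg (f i) := by
  classical
  induction s using Finset.induction_on with
  | empty => simp
  | insert a s ha ih => rw [Finset.sum_insert ha, Finset.prod_insert ha, expNeg_add, ih]

/-! ## Configurations as counting measures -/

lemma measurableSet_lt_card (n : ℕ) : MeasurableSet {x : Config | (n : ℕ∞) < x.1} :=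
  measurable_fst (MeasurableSet.of_discrete (s := {m : ℕ∞ | (n : ℕ∞) < m}))

lemma measurable_point (n : ℕ) : Measurable (fun x : Config => x.2 n) :=
  (measurable_pi_apply n).comp measurable_snd

open Classical in
/-- The sum of the values of `f` at the points of a configuration. -/
def Config.sum (x : Config) (f : ℂ → ℝ≥0∞) : ℝ≥0∞ :=
  ∑' n : ℕ, if (n : ℕ∞) < x.1 then f (x.2 n) else 0

lemma measurable_config_sum {f : ℂ → ℝ≥0∞} (hf : Measurable f) :
    Measurable (fun x : Config => x.sum f) := by
  refine Measurable.tsum fun n => ?_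
  exact Measurable.ite (measurableSet_lt_card n) (hf.comp (measurable_point n)) measurable_const

lemma Config.count_eq_sum (x : Config) (B : Set ℂ) : x.count B = x.sum (B.indicator 1) := by
  classical
  unfold Config.count Config.sum
  refine tsum_congr fun n => ?_
  by_cases h : (n : ℕ∞) < x.1 <;> by_cases h' : x.2 n ∈ B <;> simp [h, h']

lemma measurable_count {B : Set ℂ} (hB : MeasurableSet B) :
    Measurable (fun x : Config => x.count B) := by
  simp_rw [Config.count_eq_sum]
  exact measurable_config_sum (measurable_one.indicator hB)

open Classical in
/-- The counting measure of a configuration. -/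
def Config.toMeasure (x : Config) : Measure ℂ :=
  Measure.sum fun n : ℕ => if (n : ℕ∞) < x.1 then Measure.dirac (x.2 n) else 0

lemma Config.lintegral_toMeasure (x : Config) {f : ℂ → ℝ≥0∞} (hf : Measurable f) :
    ∫⁻ z, f z ∂x.toMeasure = x.sum f := by
  classical
  unfold Config.toMeasure Config.sum
  rw [lintegral_sum_measure]
  refine tsum_congr fun n => ?_
  split_ifs
  · exact lintegral_dirac' _ hf
  · simp

lemma Config.toMeasure_apply (x : Config) {B : Set ℂ} (hB : MeasurableSet B) :
    x.toMeasure B = x.count B := by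
  rw [← lintegral_indicator_one hB,
    Config.lintegral_toMeasure _ (measurable_one.indicator hB), Config.count_eq_sum]

/-! ## The Laplace functional of a Poisson process -/

/-- The Laplace transform of a Poisson law, summed as the exponential series of `b e ^ (-a)`. -/
lemma tsum_expNeg_poisson (a b : ℝ≥0) :
    ∑' n : ℕ, expNeg (a * n) * poissonMeasure b {n} = expNeg ((1 - expNeg a) * b) := by
  have hterm : ∀ n : ℕ, expNeg (a * n) * poissonMeasure b {n} =
      ENNReal.ofReal (Real.exp (-b) * ((b * Real.exp (-a)) ^ n / n.factorial)) := by
    intro n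
    have : ((a : ℝ≥0∞) * n) = ENNReal.ofReal (a * n) := by
      rw [ENNReal.ofReal_mul a.coe_nonneg]; simp
    rw [poissonMeasure_singleton, this, expNeg_ofReal (by positivity),
      ← ENNReal.ofReal_mul (Real.exp_nonneg _)]
    congr 1
    rw [mul_pow, ← Real.exp_nat_mul]
    ring_nf
  have hs : HasSum (fun n : ℕ => Real.exp (-b) * ((b * Real.exp (-a)) ^ n / n.factorial))
      (Real.exp (-b) * Real.exp (b * Real.exp (-a))) := by
    have := NormedSpace.expSeries_div_hasSum_exp (𝔸 := ℝ) ((b : ℝ) * Real.exp (-a))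
    rw [← Real.exp_eq_exp_ℝ] at this
    exact this.mul_left _
  have h1 : Real.exp (-a) ≤ 1 := Real.exp_le_one_iff.2 (by simp)
  simp_rw [hterm]
  rw [← ENNReal.ofReal_tsum_of_nonneg (fun n => by positivity) hs.summable, hs.tsum_eq]
  have hcoe : ((1 : ℝ≥0∞) - expNeg a) * b = ENNReal.ofReal ((1 - Real.exp (-a)) * b) := by
    rw [ENNReal.ofReal_mul (by linarith), ENNReal.ofReal_sub _ (Real.exp_nonneg _),
      ← expNeg_ofReal a.coe_nonneg]
    simp
  rw [hcoe, expNeg_ofReal (mul_nonneg (by linarith) b.coe_nonneg), ← Real.exp_add]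
  congr 2
  ring

section Laplace

variable {Ω : Type*} [MeasurableSpace Ω] {X : Ω → Config} {Λ : Measure ℂ} {μ : Measure Ω}
  [IsProbabilityMeasure μ]

lemma IsPoissonProcess.lintegral_expNeg_count (hX : IsPoissonProcess X Λ μ) (a : ℝ≥0)
    {B : Set ℂ} (hB : MeasurableSet B) (hΛ : Λ B ≠ ⊤) :
    ∫⁻ ω, expNeg (a * (X ω).count B) ∂μ = expNeg ((1 - expNeg a) * Λ B) := by
  have hm : Measurable (fun ω => (X ω).count B) := (measurable_count hB).comp hX.measurable
  set A : ℕ → Set Ω := fun n => {ω | (X ω).count B = n} with hA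
  have hAm : ∀ n, MeasurableSet (A n) := fun n => hm (measurableSet_singleton _)
  have hdisj : Pairwise (Function.onFun Disjoint A) := by
    intro i j hij
    refine Set.disjoint_left.2 fun ω hi hj => hij ?_
    have : (i : ℝ≥0∞) = j := hi.symm.trans hj
    exact_mod_cast this
  -- The count takes values in `[0, ∞]`, and its being almost surely a natural number is not
  -- assumed: it follows because the Poisson masses add up to one, which is the case `a = 0` of the
  -- Laplace transform.
  have hsum : μ (⋃ n, A n) = 1 := by
    rw [measure_iUnion hdisj hAm]
    simp_rw [hA, hX.count_law B hB hΛ]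
    have := tsum_expNeg_poisson 0 (Λ B).toNNReal
    simpa using this
  have hae : ∀ᵐ ω ∂μ, ω ∈ ⋃ n, A n := by
    rw [ae_iff, ← Set.compl_def, prob_compl_eq_zero_iff (MeasurableSet.iUnion hAm)]
    exact hsum
  rw [← Measure.restrict_eq_self_of_ae_mem hae, lintegral_iUnion hAm hdisj]
  calc ∑' n, ∫⁻ ω in A n, expNeg (a * (X ω).count B) ∂μ
      = ∑' n : ℕ, expNeg (a * n) * poissonMeasure (Λ B).toNNReal {n} := by
        refine tsum_congr fun n => ?_
        rw [setLIntegral_congr_fun (g := fun _ => expNeg (a * n)) (hAm n), setLIntegral_const,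
          ← hX.count_law B hB hΛ]
        intro ω hω
        have : (X ω).count B = n := hω
        simp [this]
    _ = _ := by rw [tsum_expNeg_poisson, ENNReal.coe_toNNReal hΛ]

/-- The counts of the level sets are independent Poisson variables, so the expectation factorises
over the levels. -/
lemma IsPoissonProcess.lintegral_expNeg_simpleFunc (hX : IsPoissonProcess X Λ μ)
    (g : SimpleFunc ℂ ℝ≥0∞) (hg : ∀ z, g z ≠ ⊤) (hΛ : ∀ y, y ≠ 0 → Λ (g ⁻¹' {y}) ≠ ⊤) :
    ∫⁻ ω, expNeg (∫⁻ z, g z ∂(X ω).toMeasure) ∂μ = expNeg (∫⁻ z, (1 - expNeg (g z)) ∂Λ) := by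
  classical
  -- The level `0` contributes nothing to either side and must be left out, since its level set may
  -- have infinite intensity.
  set s := g.range.filter (· ≠ 0) with hs
  set e := s.equivFin with he
  set y : Fin s.card → ℝ≥0∞ := fun j => (e.symm j : ℝ≥0∞) with hy
  have hys : ∀ j, y j ∈ s := fun j => (e.symm j).2
  have hy0 : ∀ j, y j ≠ 0 := fun j => (Finset.mem_filter.1 (hys j)).2
  have hyt : ∀ j, y j ≠ ⊤ := fun j => by
    obtain ⟨z, hz⟩ := SimpleFunc.mem_range.1 (Finset.mem_filter.1 (hys j)).1
    rw [← hz]; exact hg z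
  have hyinj : Function.Injective y := Subtype.val_injective.comp e.symm.injective
  have hmeas : ∀ j, MeasurableSet (g ⁻¹' {y j}) := fun j => g.measurableSet_preimage _
  have hsum : ∀ F : ℝ≥0∞ → ℝ≥0∞, F 0 = 0 → ∑ v ∈ g.range, F v = ∑ j, F (y j) := by
    intro F hF
    have h1 : ∑ v ∈ g.range, F v = ∑ v ∈ s, F v := by
      rw [hs, Finset.sum_filter_of_ne]
      intro v _ hv h0
      exact hv (h0 ▸ hF)
    rw [h1, ← Finset.sum_coe_sort s, ← e.symm.sum_comp]
  have hleft : ∀ x : Config, ∫⁻ z, g z ∂x.toMeasure = ∑ j, y j * x.count (g ⁻¹' {y j}) := by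
    intro x
    rw [SimpleFunc.lintegral_eq_lintegral, SimpleFunc.lintegral,
      hsum (fun v => v * x.toMeasure (g ⁻¹' {v})) (by simp)]
    exact Finset.sum_congr rfl fun j _ => by rw [Config.toMeasure_apply _ (hmeas j)]
  have hright : ∫⁻ z, (1 - expNeg (g z)) ∂Λ = ∑ j, (1 - expNeg (y j)) * Λ (g ⁻¹' {y j}) := by
    have : (fun z => 1 - expNeg (g z)) = g.map (fun v => 1 - expNeg v) := by
      ext z; simp
    rw [this, SimpleFunc.lintegral_eq_lintegral, SimpleFunc.map_lintegral,
      hsum (fun v => (1 - expNeg v) * Λ (g ⁻¹' {v})) (by simp)]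
  have hind := hX.count_indep s.card (fun j => g ⁻¹' {y j}) hmeas (by
    intro i j hij
    refine Set.disjoint_left.2 fun z hi hj => hij (hyinj ?_)
    exact (Set.mem_singleton_iff.1 hi).symm.trans hj)
  have hind' := hind.comp (fun j v => expNeg (y j * v)) (fun j => by fun_prop)
  simp_rw [hleft, hright, expNeg_sum]
  have hprod := lintegral_prod_eq_prod_lintegral_of_indepFun Finset.univ _ hind' (fun j =>
    (by fun_prop : Measurable fun v => expNeg (y j * v)).comp
      ((measurable_count (hmeas j)).comp hX.measurable))
  simp only [Function.comp_apply] at hprod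
  rw [hprod]
  refine Finset.prod_congr rfl fun j _ => ?_
  have := hX.lintegral_expNeg_count (y j).toNNReal (hmeas j) (hΛ _ (hy0 j))
  rwa [ENNReal.coe_toNNReal (hyt j)] at this

/-- The Laplace functional of a Poisson process. -/
theorem IsPoissonProcess.lintegral_expNeg [SigmaFinite Λ] (hX : IsPoissonProcess X Λ μ)
    {f : ℂ → ℝ≥0∞} (hf : Measurable f) :
    ∫⁻ ω, expNeg ((X ω).sum f) ∂μ = expNeg (∫⁻ z, (1 - expNeg (f z)) ∂Λ) := by
  -- Restricting to the spanning sets gives the nonzero levels finite intensity, and `eapprox` takes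
  -- only finite values: the two requirements of the simple case.
  set g : ℕ → SimpleFunc ℂ ℝ≥0∞ := fun n =>
    (SimpleFunc.eapprox f n).restrict (spanningSets Λ n) with hg
  have hgv : ∀ n z, g n z = (spanningSets Λ n).indicator (SimpleFunc.eapprox f n) z := fun n z => by
    rw [hg, SimpleFunc.restrict_apply _ (measurableSet_spanningSets Λ n)]
  have hmono : ∀ z, Monotone fun n => g n z := by
    intro z n m hnm
    simp only [hgv]
    by_cases h : z ∈ spanningSets Λ n
    · rw [Set.indicator_of_mem h, Set.indicator_of_mem (monotone_spanningSets Λ hnm h)]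
      exact SimpleFunc.monotone_eapprox f hnm z
    · rw [Set.indicator_of_notMem h]; exact zero_le
  have hlim : ∀ z, Tendsto (fun n => g n z) atTop (𝓝 (f z)) := by
    intro z
    have h1 : Tendsto (fun n => SimpleFunc.eapprox f n z) atTop (𝓝 (f z)) := by
      rw [← SimpleFunc.iSup_eapprox_apply hf z]
      exact tendsto_atTop_iSup fun n m hnm => SimpleFunc.monotone_eapprox f hnm z
    refine h1.congr' ?_
    have : z ∈ ⋃ n, spanningSets Λ n := by rw [iUnion_spanningSets]; trivial
    obtain ⟨n₀, hn₀⟩ := Set.mem_iUnion.1 this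
    filter_upwards [eventually_ge_atTop n₀] with n hn
    rw [hgv, Set.indicator_of_mem (monotone_spanningSets Λ hn hn₀)]
  have hn : ∀ n, ∫⁻ ω, expNeg (∫⁻ z, g n z ∂(X ω).toMeasure) ∂μ =
      expNeg (∫⁻ z, (1 - expNeg (g n z)) ∂Λ) := by
    intro n
    refine hX.lintegral_expNeg_simpleFunc (g n) (fun z => ?_) (fun y hy => ?_)
    · rw [hgv]
      by_cases h : z ∈ spanningSets Λ n
      · rw [Set.indicator_of_mem h]; exact (SimpleFunc.eapprox_lt_top f n z).ne
      · rw [Set.indicator_of_notMem h]; simp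
    · refine ((measure_mono ?_).trans_lt (measure_spanningSets_lt_top Λ n)).ne
      intro z hz
      by_contra h
      have : g n z = y := hz
      rw [hgv, Set.indicator_of_notMem h] at this
      exact hy this.symm
  have hL : Tendsto (fun n => ∫⁻ ω, expNeg (∫⁻ z, g n z ∂(X ω).toMeasure) ∂μ) atTop
      (𝓝 (∫⁻ ω, expNeg ((X ω).sum f) ∂μ)) := by
    refine tendsto_lintegral_of_dominated_convergence (fun _ => 1) (fun n => ?_)
      (fun n => ae_of_all _ fun ω => expNeg_le_one _) (by simp) (ae_of_all _ fun ω => ?_)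
    · simp_rw [fun ω => Config.lintegral_toMeasure (X ω) (g n).measurable]
      exact measurable_expNeg.comp ((measurable_config_sum (g n).measurable).comp hX.measurable)
    · rw [← Config.lintegral_toMeasure _ hf]
      exact (continuous_expNeg.tendsto _).comp (lintegral_tendsto_of_tendsto_of_monotone
        (fun n => (g n).measurable.aemeasurable) (ae_of_all _ hmono) (ae_of_all _ hlim))
  have hR : Tendsto (fun n => expNeg (∫⁻ z, (1 - expNeg (g n z)) ∂Λ)) atTop
      (𝓝 (expNeg (∫⁻ z, (1 - expNeg (f z)) ∂Λ))) := by
    refine (continuous_expNeg.tendsto _).comp (lintegral_tendsto_of_tendsto_of_monotone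
      (fun n => ?_) (ae_of_all _ fun z n m hnm => ?_) (ae_of_all _ fun z => ?_))
    · exact (measurable_const.sub (measurable_expNeg.comp (g n).measurable)).aemeasurable
    · exact tsub_le_tsub_left (antitone_expNeg (hmono z hnm)) 1
    · exact ENNReal.Tendsto.sub tendsto_const_nhds
        ((continuous_expNeg.tendsto _).comp (hlim z)) (Or.inl ENNReal.one_ne_top)
  exact tendsto_nhds_unique (hL.congr hn) hR

end Laplace

/-! ## Interference with exponential fading -/

/-- The function `a ↦ log (1 + a)` on `[0, ∞]`. -/
def logOneAdd (a : ℝ≥0∞) : ℝ≥0∞ := (ENNReal.log (1 + a)).toENNReal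

@[fun_prop]
lemma measurable_logOneAdd : Measurable logOneAdd := by
  unfold logOneAdd
  exact measurable_ereal_toENNReal.comp (ENNReal.measurable_log.comp (by fun_prop))

/-- Writing the factor `1 / (1 + a)` of one interferer as an exponential turns an infinite product
over the nodes into `expNeg` of a sum, to which the Laplace functional applies. -/
lemma expNeg_logOneAdd (a : ℝ≥0∞) : expNeg (logOneAdd a) = (1 + a)⁻¹ := by
  rw [expNeg, logOneAdd, EReal.coe_toENNReal, ENNReal.exp_log]
  rw [← ENNReal.log_one]
  exact ENNReal.log_monotone le_self_add

lemma logOneAdd_zero : logOneAdd 0 = 0 := by simp [logOneAdd]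

lemma expMeasure_lt (z : ℝ≥0∞) : expMeasure 1 {y | z < ENNReal.ofReal y} = expNeg z := by
  have := isProbabilityMeasure_expMeasure one_pos
  induction z using ENNReal.recTopCoe with
  | top => simp
  | coe a =>
    have h1 : {y : ℝ | (a : ℝ≥0∞) < ENNReal.ofReal y} = (Set.Iic (a : ℝ))ᶜ := by
      ext y
      rw [← ENNReal.ofReal_coe_nnreal]
      simp [ENNReal.ofReal_lt_ofReal_iff_of_nonneg a.coe_nonneg, -ENNReal.ofReal_coe_nnreal]
    have h2 : (expMeasure 1) (Set.Iic (a : ℝ)) = ENNReal.ofReal (1 - Real.exp (-a)) := by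
      rw [← ofReal_cdf, cdf_expMeasure_eq one_pos]
      simp
    rw [h1, prob_compl_eq_one_sub measurableSet_Iic, h2, ← ENNReal.ofReal_one,
      ← ENNReal.ofReal_sub, ← ENNReal.ofReal_coe_nnreal, expNeg_ofReal a.coe_nonneg]
    · congr 1; ring
    · simp

/-- Exponential tilting: `e ^ (-y) e ^ (-a y)` is `1 / (1 + a)` times the exponential density of
rate `1 + a`. For `a = ∞` the integrand vanishes almost surely, because `y > 0` almost surely. -/
lemma lintegral_expNeg_expMeasure (a : ℝ≥0∞) :
    ∫⁻ y, expNeg (a * ENNReal.ofReal y) ∂expMeasure 1 = expNeg (logOneAdd a) := by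
  have := isProbabilityMeasure_expMeasure one_pos
  rw [expNeg_logOneAdd]
  have hpos : ∀ᵐ y ∂expMeasure 1, 0 < ENNReal.ofReal y := by
    refine (mem_ae_iff_prob_eq_one (measurableSet_lt measurable_const (by fun_prop))).2 ?_
    rw [expMeasure_lt, expNeg_zero]
  induction a using ENNReal.recTopCoe with
  | top =>
    rw [lintegral_congr_ae (g := fun _ => 0)]
    · simp
    · filter_upwards [hpos] with y hy
      rw [ENNReal.top_mul hy.ne', expNeg_top]
  | coe a =>
    have ha : (0 : ℝ) < 1 + a := by positivity
    have key : ∀ y : ℝ, gammaPDF 1 1 y * expNeg (a * ENNReal.ofReal y) =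
        ENNReal.ofReal (1 + a)⁻¹ * exponentialPDF (1 + a) y := by
      intro y
      change exponentialPDF 1 y * _ = _
      rcases lt_or_ge y 0 with hy | hy
      · rw [exponentialPDF_of_neg hy, exponentialPDF_of_neg hy]; simp
      · rw [exponentialPDF_of_nonneg hy, exponentialPDF_of_nonneg hy,
          ← ENNReal.ofReal_coe_nnreal (p := a), ← ENNReal.ofReal_mul a.coe_nonneg,
          expNeg_ofReal (by positivity), ← ENNReal.ofReal_mul (by positivity),
          ← ENNReal.ofReal_mul (by positivity)]
        congr 1
        rw [← mul_assoc, inv_mul_cancel₀ ha.ne', mul_assoc, ← Real.exp_add]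
        ring_nf
    have hfin : Measurable (gammaPDF 1 1) := (measurable_gammaPDFReal 1 1).ennreal_ofReal
    rw [expMeasure, gammaMeasure, lintegral_withDensity_eq_lintegral_mul _ hfin (by fun_prop)]
    simp only [Pi.mul_apply, key]
    rw [lintegral_const_mul', lintegral_exponentialPDF_eq_one ha, mul_one,
      ENNReal.ofReal_inv_of_pos ha, ENNReal.ofReal_add zero_le_one a.coe_nonneg]
    · simp
    · simp

section Fading

variable {Ω : Type*} {J : Type*} [Countable J]

lemma measurable_tsum_fading {mΩ : MeasurableSpace Ω} {h : J → Ω → ℝ} (hm : ∀ j, Measurable (h j))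
    (a : J → ℝ≥0∞) : Measurable fun ω => ∑' j, a j * ENNReal.ofReal (h j ω) :=
  Measurable.tsum fun j => (hm j).ennreal_ofReal.const_mul (a j)

variable [MeasurableSpace Ω] {μ : Measure Ω} [IsProbabilityMeasure μ]

/-- Independence factorises finite partial sums; the limit along finite sets is dominated by `1`. -/
lemma lintegral_expNeg_fading {h : J → Ω → ℝ} (hm : ∀ j, Measurable (h j))
    (hl : ∀ j, μ.map (h j) = expMeasure 1) (hi : iIndepFun h μ) (a : J → ℝ≥0∞) :
    ∫⁻ ω, expNeg (∑' j, a j * ENNReal.ofReal (h j ω)) ∂μ = expNeg (∑' j, logOneAdd (a j)) := by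
  have hL : Tendsto (fun s : Finset J => ∫⁻ ω, expNeg (∑ j ∈ s, a j * ENNReal.ofReal (h j ω)) ∂μ)
      atTop (𝓝 (∫⁻ ω, expNeg (∑' j, a j * ENNReal.ofReal (h j ω)) ∂μ)) := by
    refine tendsto_lintegral_filter_of_dominated_convergence (fun _ => 1)
      (Eventually.of_forall fun s => ?_)
      (Eventually.of_forall fun s => ae_of_all _ fun ω => expNeg_le_one _) (by simp)
      (ae_of_all _ fun ω => (continuous_expNeg.tendsto _).comp ENNReal.summable.hasSum)
    exact measurable_expNeg.comp
      (Finset.measurable_fun_sum _ fun j _ => (hm j).ennreal_ofReal.const_mul (a j))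
  have hR : Tendsto (fun s : Finset J => expNeg (∑ j ∈ s, logOneAdd (a j)))
      atTop (𝓝 (expNeg (∑' j, logOneAdd (a j)))) :=
    (continuous_expNeg.tendsto _).comp ENNReal.summable.hasSum
  refine tendsto_nhds_unique (hL.congr fun s => ?_) hR
  have hg : ∀ j, Measurable fun y : ℝ => expNeg (a j * ENNReal.ofReal y) := fun j => by fun_prop
  simp_rw [expNeg_sum]
  have := lintegral_prod_eq_prod_lintegral_of_indepFun s _
    (hi.comp (fun j y => expNeg (a j * ENNReal.ofReal y)) hg) fun j => (hg j).comp (hm j)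
  simp only [Function.comp_apply] at this
  rw [this]
  refine Finset.prod_congr rfl fun j _ => ?_
  rw [← lintegral_expNeg_expMeasure, ← hl j, lintegral_map (hg j) (hm j)]

/-- The probability that an exponential signal exceeds an independent exponentially faded sum. -/
lemma measure_fading_lt {h : Option J → Ω → ℝ} (hm : ∀ j, Measurable (h j))
    (hl : ∀ j, μ.map (h j) = expMeasure 1) (hi : iIndepFun h μ) (c : ℝ≥0∞) (a : J → ℝ≥0∞) :
    μ {ω | c + ∑' j, a j * ENNReal.ofReal (h (some j) ω) < ENNReal.ofReal (h none ω)} =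
      expNeg c * expNeg (∑' j, logOneAdd (a j)) := by
  set Z : Ω → ℝ≥0∞ := fun ω => c + ∑' j, a j * ENNReal.ofReal (h (some j) ω) with hZ
  have hZm : Measurable Z := measurable_const.add (measurable_tsum_fading (fun j => hm _) a)
  -- `Z` depends on a whole family of fading variables, so independence is argued with the
  -- σ-algebras generated by the disjoint index sets `range some` and `{none}`.
  have hind : IndepFun Z (h none) μ := by
    have h1 := indep_iSup_of_disjoint (m := fun i => MeasurableSpace.comap (h i) inferInstance)
      (fun i => (hm i).comap_le) hi (S := Set.range some) (T := {none})
      (Set.disjoint_singleton_right.2 (by simp))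
    refine indep_of_indep_of_le_left (indep_of_indep_of_le_right h1 ?_) ?_
    · exact le_iSup₂_of_le none rfl le_rfl
    · refine Measurable.comap_le ?_
      refine Measurable.add measurable_const (measurable_tsum_fading (fun j => ?_) a)
      refine Measurable.mono (comap_measurable (h (some j))) ?_ le_rfl
      exact le_iSup₂_of_le (f := fun i (_ : i ∈ Set.range some) =>
        MeasurableSpace.comap (h i) inferInstance) (some j) ⟨j, rfl⟩ le_rfl
  have := isProbabilityMeasure_expMeasure one_pos
  have hS : MeasurableSet {p : ℝ≥0∞ × ℝ | p.1 < ENNReal.ofReal p.2} :=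
    measurableSet_lt measurable_fst (by fun_prop)
  have hmap := hind.map_prod_eq_prod_map_map hZm.aemeasurable (hm none).aemeasurable
  calc μ {ω | Z ω < ENNReal.ofReal (h none ω)}
      = μ.map (fun ω => (Z ω, h none ω)) {p | p.1 < ENNReal.ofReal p.2} := by
        rw [Measure.map_apply (hZm.prodMk (hm none)) hS]; rfl
    _ = ∫⁻ z, expMeasure 1 {y | z < ENNReal.ofReal y} ∂μ.map Z := by
        rw [hmap, hl none, Measure.prod_apply hS]; rfl
    _ = ∫⁻ ω, expNeg (Z ω) ∂μ := by
        simp_rw [expMeasure_lt]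
        rw [lintegral_map measurable_expNeg hZm]
    _ = _ := by
        simp_rw [hZ, expNeg_add]
        have hm' : Measurable fun ω => expNeg (∑' j, a j * ENNReal.ofReal (h (some j) ω)) :=
          measurable_expNeg.comp (measurable_tsum_fading (fun j => hm (some j)) a)
        rw [lintegral_const_mul _ hm', lintegral_expNeg_fading (fun j => hm _) (fun j => hl _)
            (hi.precomp (Option.some_injective J))]

end Fading

/-! ## Conditional distribution of the SINR given the link length -/

/-- The received power of a node at `z` of class `c` and tier `t` without fading, times `s`. -/
def Params.gain (net : Params) (s : ℝ≥0∞) (c : NodeClass) (t : Fin 2) (z : ℂ) : ℝ≥0∞ :=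
  s * (ENNReal.ofReal (net.txPower c t) * ENNReal.ofReal ‖z‖ ^ (-net.α))

lemma Params.measurable_gain (net : Params) (s : ℝ≥0∞) (c : NodeClass) (t : Fin 2) :
    Measurable (net.gain s c t) := by
  unfold Params.gain
  fun_prop

/-- The total count is Poisson of mean `0`. This removes the classes whose intensity vanishes at the
extreme thresholds. -/
lemma IsPoissonProcess.ae_card_eq_zero {Ω : Type*} [MeasurableSpace Ω] {X : Ω → Config}
    {μ : Measure Ω} [IsProbabilityMeasure μ] (hX : IsPoissonProcess X 0 μ) :
    ∀ᵐ ω ∂μ, ∀ n : ℕ, ¬ (n : ℕ∞) < (X ω).1 := by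
  have h := hX.count_law Set.univ MeasurableSet.univ (by simp) 0
  have hm : MeasurableSet {ω | (X ω).count Set.univ = ((0 : ℕ) : ℝ≥0∞)} :=
    ((measurable_count MeasurableSet.univ).comp hX.measurable) (measurableSet_singleton _)
  have h1 : ∀ᵐ ω ∂μ, (X ω).count Set.univ = ((0 : ℕ) : ℝ≥0∞) := by
    refine (mem_ae_iff_prob_eq_one hm).2 ?_
    rw [h, poissonMeasure_singleton]
    simp
  filter_upwards [h1] with ω hω n hn
  rw [Config.count, Nat.cast_zero, ENNReal.tsum_eq_zero] at hω
  have := hω n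
  simp [hn] at this

section Coverage

variable {net : Params} {Ω : Type*} [MeasurableSpace Ω] {B : BaseStations net Ω}
  {γ : Fin 2 → ℝ≥0∞} {k : Fin 2} {d : Dir} {Ω' : Type*} [MeasurableSpace Ω']
  (L : Link B γ k d Ω')

instance : IsMarkovKernel L.κ := L.markov

/-- Measurability is recorded inside the Poisson property for each `r > 0` but does not involve `r`,
so `r = 1` serves. -/
lemma Link.measurable_nodes (j : NodeClass × Fin 2) : Measurable (L.nodes j) :=
  (L.nodes_poisson 1 one_pos j.1 j.2).measurable

lemma Link.measurable_classInterference (c : NodeClass) (t : Fin 2) :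
    Measurable (L.classInterference c t) := by
  unfold Link.classInterference
  refine Measurable.tsum fun n => Measurable.ite
    (L.measurable_nodes (c, t) (measurableSet_lt_card n)) ?_ measurable_const
  have h1 := L.fade_measurable (some (c, t, n))
  have h2 : Measurable fun ω => (L.nodes (c, t) ω).2 n :=
    (measurable_point n).comp (L.measurable_nodes (c, t))
  exact (h1.ennreal_ofReal.const_mul _).mul (h2.norm.ennreal_ofReal.pow_const _)

lemma Link.measurable_interference (userFD : Bool) (i t : Fin 2) :
    Measurable (L.interference userFD i t) := by
  unfold Link.interference
  refine Measurable.add (Measurable.add (L.measurable_classInterference _ _) ?_) ?_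
  · split_ifs
    · exact L.measurable_classInterference _ _
    · exact measurable_const
  · split_ifs <;> exact L.measurable_classInterference _ _

lemma Link.measurable_sinr (userFD : Bool) (ρ : ℝ≥0) (i : Fin 2) :
    Measurable fun p : ℝ × Ω' => L.sinr userFD ρ i p.1 p.2 := by
  unfold Link.sinr
  have h1 : Measurable fun p : ℝ × Ω' => L.fade none p.2 :=
    (L.fade_measurable none).comp measurable_snd
  have h2 : Measurable fun p : ℝ × Ω' => ∑ t, L.interference userFD i t p.2 :=
    Finset.measurable_fun_sum _ fun t _ => (L.measurable_interference userFD i t).comp measurable_snd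
  fun_prop

lemma Link.sinr_nonneg (userFD : Bool) (ρ : ℝ≥0) (i : Fin 2) (r : ℝ) (ω : Ω') :
    0 ≤ L.sinr userFD ρ i r ω := ENNReal.toReal_nonneg

/-- Transmit power of the useful signal. -/
def Params.sigPower (net : Params) (k : Fin 2) (d : Dir) : ℝ :=
  match d with | .down => net.P k | .up => net.PU

lemma Params.sigPower_pos (net : Params) (k : Fin 2) (d : Dir) : 0 < net.sigPower k d := by
  cases d
  · exact net.P_pos k
  · exact net.PU_pos

lemma Link.sinr_eq (userFD : Bool) (ρ : ℝ≥0) (i : Fin 2) (r : ℝ) (ω : Ω') :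
    L.sinr userFD ρ i r ω =
      (ENNReal.ofReal (net.sigPower k d * L.fade none ω * r ^ (-net.α)) /
        (ρ + ∑ t, L.interference userFD i t ω + ENNReal.ofReal net.noise)).toReal := by
  cases d <;> rfl

open Classical in
/-- The coefficients of the fading variables in the interference from the nodes of class `c`. -/
def Params.fadeCoeff (net : Params) (s : ℝ≥0∞) (c : NodeClass) (x : NodeClass × Fin 2 → Config)
    (p : Fin 2 × ℕ) : ℝ≥0∞ :=
  if (p.2 : ℕ∞) < (x (c, p.1)).1 then net.gain s c p.1 ((x (c, p.1)).2 p.2) else 0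

lemma Params.measurable_fadeCoeff (net : Params) (s : ℝ≥0∞) (c : NodeClass) (p : Fin 2 × ℕ) :
    Measurable fun x => net.fadeCoeff s c x p := by
  have h : Measurable fun x : NodeClass × Fin 2 → Config => x (c, p.1) := measurable_pi_apply _
  exact Measurable.ite (h (measurableSet_lt_card p.2))
    ((net.measurable_gain s c p.1).comp ((measurable_point p.2).comp h)) measurable_const

/-- Both tiers are gathered into one series, linear in the fading with coefficients that depend on
the nodes only: the form that `measure_fading_lt` needs once the nodes are frozen. -/
lemma Link.mul_sum_classInterference (s : ℝ≥0∞) (c : NodeClass) (ω : Ω') :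
    s * ∑ t, L.classInterference c t ω =
      ∑' p : Fin 2 × ℕ, net.fadeCoeff s c (fun j => L.nodes j ω) p *
        ENNReal.ofReal (L.fade (some (c, p.1, p.2)) ω) := by
  classical
  rw [ENNReal.tsum_prod', tsum_fintype, Finset.mul_sum]
  refine Finset.sum_congr rfl fun t _ => ?_
  rw [Link.classInterference, ← ENNReal.tsum_mul_left]
  refine tsum_congr fun n => ?_
  unfold Params.fadeCoeff Params.gain
  split_ifs
  · ring
  · simp

lemma Params.tsum_logOneAdd_fadeCoeff (net : Params) (s : ℝ≥0∞) (c : NodeClass)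
    (x : NodeClass × Fin 2 → Config) :
    ∑' p, logOneAdd (net.fadeCoeff s c x p) =
      ∑ t, (x (c, t)).sum (fun z => logOneAdd (net.gain s c t z)) := by
  classical
  rw [ENNReal.tsum_prod', tsum_fintype]
  refine Finset.sum_congr rfl fun t _ => tsum_congr fun n => ?_
  unfold Params.fadeCoeff
  split_ifs
  · rfl
  · exact logOneAdd_zero

/-- The probability that the faded signal exceeds the noise plus the interference from the nodes of
class `c`. -/
theorem Link.measure_interference_lt {r : ℝ} (hr : 0 < r) (c : NodeClass)
    [∀ t, SigmaFinite (B.intensity γ k d c t r)] (s b : ℝ≥0∞) :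
    L.κ r {ω | b + s * ∑ t, L.classInterference c t ω < ENNReal.ofReal (L.fade none ω)} =
      expNeg b * ∏ t, expNeg (∫⁻ z, (1 - (1 + net.gain s c t z)⁻¹) ∂B.intensity γ k d c t r) := by
  set fd : Ω' → Option (NodeClass × Fin 2 × ℕ) → ℝ := fun ω i => L.fade i ω with hfd
  set nd : Ω' → NodeClass × Fin 2 → Config := fun ω j => L.nodes j ω with hnd
  have hfdm : Measurable fd := measurable_pi_lambda _ L.fade_measurable
  have hndm : Measurable nd := measurable_pi_lambda _ L.measurable_nodes
  set S : Set ((Option (NodeClass × Fin 2 × ℕ) → ℝ) × (NodeClass × Fin 2 → Config)) :=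
    {p | b + ∑' q : Fin 2 × ℕ, net.fadeCoeff s c p.2 q *
      ENNReal.ofReal (p.1 (some (c, q.1, q.2))) < ENNReal.ofReal (p.1 none)} with hS
  have hSm : MeasurableSet S := by
    refine measurableSet_lt (measurable_const.add (Measurable.tsum fun q => ?_)) ?_
    · exact ((net.measurable_fadeCoeff s c q).comp measurable_snd).mul
        ((measurable_pi_apply _).comp measurable_fst).ennreal_ofReal
    · exact ((measurable_pi_apply _).comp measurable_fst).ennreal_ofReal
  -- Fading and nodes have a product law, so Fubini allows integrating out the fading for frozen
  -- nodes `x` first, and the nodes afterwards.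
  have hmap := (L.fade_nodes_indep r hr).map_prod_eq_prod_map_map hfdm.aemeasurable hndm.aemeasurable
  -- Only the signal and the class `c` matter; an injective reindexing of the fading family
  -- preserves independence.
  have hinj : Function.Injective
      (Option.map fun q : Fin 2 × ℕ => ((c, q.1, q.2) : NodeClass × Fin 2 × ℕ)) :=
    Option.map_injective fun q q' h => by
      simp only [Prod.mk.injEq, true_and] at h
      exact Prod.ext h.1 h.2
  have hsect : ∀ x, (L.κ r).map fd ((fun y => (y, x)) ⁻¹' S) =
      expNeg b * expNeg (∑ t, (x (c, t)).sum (fun z => logOneAdd (net.gain s c t z))) := by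
    intro x
    rw [Measure.map_apply hfdm (hSm.preimage (by fun_prop)), ← Params.tsum_logOneAdd_fadeCoeff]
    exact measure_fading_lt (μ := L.κ r) (J := Fin 2 × ℕ)
      (h := fun o => L.fade (Option.map (fun q : Fin 2 × ℕ => (c, q.1, q.2)) o))
      (fun o => L.fade_measurable _) (fun o => L.fade_law r hr _)
      ((L.fade_indep r hr).precomp hinj) b (net.fadeCoeff s c x)
  have hfm : ∀ t, Measurable fun z => logOneAdd (net.gain s c t z) := fun t =>
    measurable_logOneAdd.comp (net.measurable_gain s c t)
  have hgm : ∀ t, Measurable fun y : Config => expNeg (y.sum fun z => logOneAdd (net.gain s c t z)) :=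
    fun t => measurable_expNeg.comp (measurable_config_sum (hfm t))
  calc L.κ r {ω | b + s * ∑ t, L.classInterference c t ω < ENNReal.ofReal (L.fade none ω)}
      = (L.κ r).map (fun ω => (fd ω, nd ω)) S := by
        rw [Measure.map_apply (hfdm.prodMk hndm) hSm]
        simp_rw [Link.mul_sum_classInterference]
        rfl
    _ = ∫⁻ x, expNeg b * expNeg (∑ t, (x (c, t)).sum (fun z => logOneAdd (net.gain s c t z)))
          ∂(L.κ r).map nd := by
        have : SFinite ((L.κ r).map nd) := inferInstance
        rw [hmap, Measure.prod_apply_symm hSm]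
        exact lintegral_congr hsect
    _ = expNeg b * ∫⁻ ω, ∏ t, expNeg ((L.nodes (c, t) ω).sum fun z =>
          logOneAdd (net.gain s c t z)) ∂L.κ r := by
        simp_rw [expNeg_sum]
        have hprodm : Measurable fun x : NodeClass × Fin 2 → Config =>
            ∏ t, expNeg ((x (c, t)).sum fun z => logOneAdd (net.gain s c t z)) :=
          Finset.measurable_fun_prod _ fun t _ => (hgm t).comp (measurable_pi_apply _)
        rw [lintegral_const_mul _ hprodm, lintegral_map hprodm hndm]
    _ = _ := by
        congr 1
        have hind := ((L.nodes_indep r hr).precomp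
          (g := fun t : Fin 2 => ((c, t) : NodeClass × Fin 2)) (Prod.mk_right_injective c)).comp
          (fun t y => expNeg (y.sum fun z => logOneAdd (net.gain s c t z))) hgm
        have := lintegral_prod_eq_prod_lintegral_of_indepFun Finset.univ _ hind
          fun t => (hgm t).comp (L.measurable_nodes (c, t))
        simp only [Function.comp_apply] at this
        rw [this]
        refine Finset.prod_congr rfl fun t _ => ?_
        rw [(L.nodes_poisson r hr c t).lintegral_expNeg (hfm t)]
        simp_rw [expNeg_logOneAdd]

/-- The interference from the nodes of class `c` is almost surely finite. -/
lemma Link.ae_interference_ne_top {r : ℝ} (hr : 0 < r) (c : NodeClass)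
    [∀ t, SigmaFinite (B.intensity γ k d c t r)]
    (hfin : ∀ t, ∫⁻ z, (1 - (1 + net.gain 1 c t z)⁻¹) ∂B.intensity γ k d c t r ≠ ⊤)
    (hzero : ∀ t, B.intensity γ k d c t r {0} = 0) :
    ∀ᵐ ω ∂L.κ r, ∑ t, L.classInterference c t ω ≠ ⊤ := by
  set I : Ω' → ℝ≥0∞ := fun ω => ∑ t, L.classInterference c t ω with hI
  have hIm : Measurable I :=
    Finset.measurable_fun_sum _ fun t _ => L.measurable_classInterference c t
  -- For `s > 0` the event `s I < h` forces `I < ∞`, so its probability, the Laplace transform of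
  -- `I` at `s`, bounds `ℙ(I < ∞)` from below. Along this sequence `s → 0` the transform tends to
  -- `1`.
  set s : ℕ → ℝ≥0∞ := fun n => ((n : ℝ≥0∞) + 1)⁻¹ with hs
  have hs1 : ∀ n, s n ≤ 1 := fun n => by
    rw [hs, ENNReal.inv_le_one]; exact le_add_self
  have hs0 : ∀ n, s n ≠ 0 := fun n => by simp [hs]
  have hst : Tendsto s atTop (𝓝 0) := by
    have : Tendsto (fun n : ℕ => ((n + 1 : ℕ) : ℝ≥0∞)⁻¹) atTop (𝓝 0) :=
      ENNReal.tendsto_inv_nat_nhds_zero.comp (tendsto_add_atTop_nat 1)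
    simpa [hs] using this
  have hle : ∀ n, ∏ t, expNeg (∫⁻ z, (1 - (1 + net.gain (s n) c t z)⁻¹)
      ∂B.intensity γ k d c t r) ≤ L.κ r {ω | I ω ≠ ⊤} := by
    intro n
    have := L.measure_interference_lt hr c (s n) 0
    rw [expNeg_zero, one_mul] at this
    rw [← this]
    refine measure_mono fun ω hω h => ?_
    have hω' : 0 + s n * I ω < ENNReal.ofReal (L.fade none ω) := hω
    rw [h, ENNReal.mul_top (hs0 n)] at hω'
    simp at hω'
  have hlim : Tendsto (fun n => ∏ t, expNeg (∫⁻ z, (1 - (1 + net.gain (s n) c t z)⁻¹)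
      ∂B.intensity γ k d c t r)) atTop (𝓝 (∏ _t : Fin 2, 1)) := by
    refine ENNReal.tendsto_finsetProd_of_ne_top _ (fun t _ => ?_) (by simp)
    have hgm : ∀ n, Measurable fun z => 1 - (1 + net.gain (s n) c t z)⁻¹ := fun n =>
      measurable_const.sub (measurable_const.add (net.measurable_gain _ c t)).inv
    have : Tendsto (fun n => ∫⁻ z, (1 - (1 + net.gain (s n) c t z)⁻¹) ∂B.intensity γ k d c t r)
        atTop (𝓝 (∫⁻ z, 0 ∂B.intensity γ k d c t r)) := by
      refine tendsto_lintegral_of_dominated_convergence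
        (fun z => 1 - (1 + net.gain 1 c t z)⁻¹) hgm (fun n => ae_of_all _ fun z => ?_) (hfin t) ?_
      · refine tsub_le_tsub_left (ENNReal.inv_le_inv.2 (add_le_add_right ?_ 1)) 1
        exact mul_le_mul_left (hs1 n) _
      -- At the origin the path loss is infinite and the gain does not tend to `0` with `s`; the
      -- origin is a null set.
      · have h0 : ∀ᵐ z ∂B.intensity γ k d c t r, z ≠ 0 := by
          rw [ae_iff]; simpa using hzero t
        filter_upwards [h0] with z hz
        have hzt : ENNReal.ofReal (net.txPower c t) * ENNReal.ofReal ‖z‖ ^ (-net.α) ≠ ⊤ := by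
          refine ENNReal.mul_ne_top ENNReal.ofReal_ne_top ?_
          exact ENNReal.rpow_ne_top_of_ne_zero (by simpa using hz) ENNReal.ofReal_ne_top
        have h1 : Tendsto (fun n => net.gain (s n) c t z) atTop (𝓝 0) := by
          have := ENNReal.Tendsto.mul_const hst (Or.inr hzt)
          rwa [zero_mul] at this
        have h2 : Tendsto (fun n => (1 + net.gain (s n) c t z)⁻¹) atTop (𝓝 (1 + 0)⁻¹) :=
          (continuous_inv.tendsto _).comp (tendsto_const_nhds.add h1)
        have h3 := ENNReal.Tendsto.sub (tendsto_const_nhds (x := (1 : ℝ≥0∞))) h2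
          (Or.inl ENNReal.one_ne_top)
        simpa using h3
    simpa [Function.comp_def] using (continuous_expNeg.tendsto _).comp this
  have h1 : 1 ≤ L.κ r {ω | I ω ≠ ⊤} := by
    have := le_of_tendsto' hlim hle
    simpa using this
  have hm : MeasurableSet {ω | I ω ≠ ⊤} := (hIm (measurableSet_singleton ⊤)).compl
  exact (mem_ae_iff_prob_eq_one hm).2 (le_antisymm prob_le_one h1)

/-- The conditional distribution of the SINR given the link length, if only the nodes of class `c`
interfere. -/
theorem Link.measure_lt_sinr {r : ℝ} (hr : 0 < r) (c : NodeClass)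
    [∀ t, SigmaFinite (B.intensity γ k d c t r)]
    (hfin : ∀ t, ∫⁻ z, (1 - (1 + net.gain 1 c t z)⁻¹) ∂B.intensity γ k d c t r ≠ ⊤)
    (hzero : ∀ t, B.intensity γ k d c t r {0} = 0) {userFD : Bool} {i : Fin 2}
    (hI : ∀ᵐ ω ∂L.κ r, ∑ t, L.interference userFD i t ω = ∑ t, L.classInterference c t ω)
    {T : ℝ} (hT : 0 ≤ T) :
    L.κ r {ω | T < L.sinr userFD 0 i r ω} =
      expNeg (ENNReal.ofReal (T * r ^ net.α / net.sigPower k d * net.noise)) *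
        ∏ t, expNeg (∫⁻ z, (1 - (1 + net.gain (ENNReal.ofReal (T * r ^ net.α / net.sigPower k d))
          c t z)⁻¹) ∂B.intensity γ k d c t r) := by
  rw [← L.measure_interference_lt hr c]
  refine measure_congr ?_
  -- Finiteness of the interference matters at `T = 0`: if `I = ∞` the SINR is `0` and does not
  -- exceed `T`, whereas on the other side `0 * ∞ = 0` and the inequality would hold for any
  -- positive fading.
  filter_upwards [hI, L.ae_interference_ne_top hr c hfin hzero] with ω hω htop
  refine propext ?_
  change T < L.sinr userFD 0 i r ω ↔
    _ + _ * ∑ t, L.classInterference c t ω < ENNReal.ofReal (L.fade none ω)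
  have hp := net.sigPower_pos k d
  have hra : 0 < r ^ net.α := Real.rpow_pos_of_pos hr _
  set I := ∑ t, L.classInterference c t ω with hIdef
  set D := I + ENNReal.ofReal net.noise with hD
  have hD0 : D ≠ 0 := by simp [hD, net.noise_pos]
  have hDt : D ≠ ⊤ := ENNReal.add_ne_top.2 ⟨htop, ENNReal.ofReal_ne_top⟩
  have hsinr : L.sinr userFD 0 i r ω =
      (ENNReal.ofReal (net.sigPower k d * L.fade none ω * r ^ (-net.α)) / D).toReal := by
    rw [L.sinr_eq, hω, ENNReal.coe_zero, zero_add]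
  -- The factor that recovers the fading from the received signal power; multiplying both sides by
  -- it isolates `h`.
  set u := r ^ net.α / net.sigPower k d with hu
  have hu0 : 0 < u := by positivity
  have hq : ENNReal.ofReal (L.fade none ω) =
      ENNReal.ofReal (net.sigPower k d * L.fade none ω * r ^ (-net.α)) * ENNReal.ofReal u := by
    rw [← ENNReal.ofReal_mul' hu0.le]
    congr 1
    rw [hu, Real.rpow_neg hr.le]
    field_simp
  rw [hsinr, ← ENNReal.ofReal_lt_iff_lt_toReal hT (ENNReal.div_ne_top ENNReal.ofReal_ne_top hD0),
    ENNReal.lt_div_iff_mul_lt (Or.inl hD0) (Or.inl hDt), hq,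
    ← ENNReal.mul_lt_mul_iff_left (c := ENNReal.ofReal u) (by simpa using hu0)
      ENNReal.ofReal_ne_top]
  have h1 : T * r ^ net.α / net.sigPower k d = T * u := by rw [hu]; ring
  rw [h1, ENNReal.ofReal_mul (mul_nonneg hT hu0.le), ENNReal.ofReal_mul hT, hD]
  ring_nf

end Coverage

/-! ## Radial integrals in the plane -/

/-- Integrals of radial functions over a region all of whose circular sections are measurable. -/
lemma lintegral_radial {A : Set ℂ} (hA : MeasurableSet A) {G : ℝ → ℝ≥0∞} (hG : Measurable G)
    (m : ℝ → ℝ≥0∞)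
    (hm : ∀ y, 0 < y → volume (Set.Ioo (-Real.pi) Real.pi ∩
      {θ | Complex.polarCoord.symm (y, θ) ∈ A}) = m y) :
    ∫⁻ z in A, G ‖z‖ = ∫⁻ y in Set.Ioi 0, m y * (ENNReal.ofReal y * G y) := by
  have hp : Measurable fun p : ℝ × ℝ => Complex.polarCoord.symm p := by
    simp only [Complex.polarCoord_symm_apply]
    fun_prop
  have hf : Measurable (A.indicator fun z => G ‖z‖) := (hG.comp measurable_norm).indicator hA
  have htarget : polarCoord.target = Set.Ioi (0 : ℝ) ×ˢ Set.Ioo (-Real.pi) Real.pi := rfl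
  rw [← lintegral_indicator hA, ← Complex.lintegral_comp_polarCoord_symm, htarget,
    Measure.volume_eq_prod, ← Measure.prod_restrict, lintegral_prod _ (by
      exact ((measurable_fst.ennreal_ofReal).mul (hf.comp hp)).aemeasurable)]
  refine setLIntegral_congr_fun measurableSet_Ioi fun y hy => ?_
  have hy' : (0 : ℝ) < y := hy
  have hS : MeasurableSet {θ | Complex.polarCoord.symm (y, θ) ∈ A} :=
    hp.comp measurable_prodMk_left hA
  have : ∀ θ : ℝ, ENNReal.ofReal (y, θ).1 • A.indicator (fun z => G ‖z‖)
      (Complex.polarCoord.symm (y, θ)) =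
      {θ | Complex.polarCoord.symm (y, θ) ∈ A}.indicator (fun _ => ENNReal.ofReal y * G y) θ := by
    intro θ
    by_cases h : Complex.polarCoord.symm (y, θ) ∈ A
    · have h' : θ ∈ {θ | Complex.polarCoord.symm (y, θ) ∈ A} := h
      rw [Set.indicator_of_mem h, Set.indicator_of_mem h',
        Complex.norm_polarCoord_symm, abs_of_pos hy', smul_eq_mul]
    · have h' : θ ∉ {θ | Complex.polarCoord.symm (y, θ) ∈ A} := h
      rw [Set.indicator_of_notMem h, Set.indicator_of_notMem h', smul_zero]
  simp only [this]
  rw [lintegral_indicator_const hS, Measure.restrict_apply hS, Set.inter_comm, hm y hy', mul_comm]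

lemma norm_polarCoord_symm_of_pos {y : ℝ} (hy : 0 < y) (θ : ℝ) :
    ‖Complex.polarCoord.symm (y, θ)‖ = y := by
  rw [Complex.norm_polarCoord_symm, abs_of_pos hy]

lemma lintegral_radial_of_le_norm {a : ℝ} (ha : 0 ≤ a) {G : ℝ → ℝ≥0∞} (hG : Measurable G) :
    ∫⁻ z in {z : ℂ | a ≤ ‖z‖}, G ‖z‖ =
      ENNReal.ofReal (2 * Real.pi) * ∫⁻ y in Set.Ioi a, ENNReal.ofReal y * G y := by
  rw [lintegral_radial (measurableSet_le measurable_const measurable_norm) hG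
    ((Set.Ici a).indicator fun _ => ENNReal.ofReal (2 * Real.pi))]
  · have : ∀ y, (Set.Ici a).indicator (fun _ => ENNReal.ofReal (2 * Real.pi)) y *
        (ENNReal.ofReal y * G y) =
        (Set.Ici a).indicator (fun y => ENNReal.ofReal (2 * Real.pi) * (ENNReal.ofReal y * G y)) y :=
      fun y => by by_cases h : y ∈ Set.Ici a <;> simp [h]
    simp_rw [this]
    have hm : Measurable fun y => ENNReal.ofReal y * G y := by fun_prop
    rw [lintegral_indicator measurableSet_Ici, Measure.restrict_restrict measurableSet_Ici,
      lintegral_const_mul _ hm]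
    congr 1
    rw [← Measure.restrict_restrict measurableSet_Ici, Measure.restrict_congr_set
      (Ioi_ae_eq_Ici (μ := volume.restrict (Set.Ioi (0 : ℝ))) (a := a)).symm,
      Measure.restrict_restrict measurableSet_Ioi, Set.inter_eq_left.2 (Set.Ioi_subset_Ioi ha)]
  · intro y hy
    simp only [Set.mem_ofPred_eq, norm_polarCoord_symm_of_pos hy]
    by_cases h : a ≤ y
    · simp only [h, Set.ofPred_true, Set.inter_univ, Real.volume_Ioo, Set.mem_Ici,
        Set.indicator_of_mem]
      congr 1; ring
    · simp [h]

/-- A circle of radius `y < a` loses the angles in an interval of length `2π (1 - p)` and keeps `2π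
p`; from radius `a` on, circles are complete. -/
lemma lintegral_radial_compl_sector {a p : ℝ} (ha : 0 ≤ a) (hp0 : 0 < p) (hp1 : p ≤ 1)
    {G : ℝ → ℝ≥0∞} (hG : Measurable G) :
    ∫⁻ z in {z : ℂ | ‖z‖ < a ∧ |z.arg| ≤ Real.pi * (1 - p)}ᶜ, G ‖z‖ =
      ENNReal.ofReal (2 * Real.pi * p) * (∫⁻ y in Set.Ioc 0 a, ENNReal.ofReal y * G y) +
        ENNReal.ofReal (2 * Real.pi) * ∫⁻ y in Set.Ioi a, ENNReal.ofReal y * G y := by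
  have hpi := Real.pi_pos
  have hA : MeasurableSet {z : ℂ | ‖z‖ < a ∧ |z.arg| ≤ Real.pi * (1 - p)} :=
    (measurableSet_lt measurable_norm measurable_const).inter
      (measurableSet_le Complex.measurable_arg.norm measurable_const)
  have hm : Measurable fun y => ENNReal.ofReal y * G y := by fun_prop
  rw [lintegral_radial hA.compl hG
    (fun y => if y < a then ENNReal.ofReal (2 * Real.pi * p) else ENNReal.ofReal (2 * Real.pi))]
  · rw [← Set.Ioc_union_Ioi_eq_Ioi ha, lintegral_union measurableSet_Ioi
      (Set.Ioc_disjoint_Ioi le_rfl), ← lintegral_const_mul _ hm, ← lintegral_const_mul _ hm]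
    congr 1
    · rw [← restrict_Ioo_eq_restrict_Ioc]
      refine setLIntegral_congr_fun measurableSet_Ioo fun y hy => ?_
      simp [hy.2]
    · refine setLIntegral_congr_fun measurableSet_Ioi fun y hy => ?_
      simp [not_lt.2 (le_of_lt (Set.mem_Ioi.1 hy))]
  · intro y hy
    simp only [Set.mem_compl_iff, Set.mem_ofPred_eq, norm_polarCoord_symm_of_pos hy]
    by_cases h : y < a
    · have hset : Set.Ioo (-Real.pi) Real.pi ∩
          {θ | ¬ (y < a ∧ |(Complex.polarCoord.symm (y, θ)).arg| ≤ Real.pi * (1 - p))} =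
          Set.Ioo (-Real.pi) Real.pi \ Set.Icc (-(Real.pi * (1 - p))) (Real.pi * (1 - p)) := by
        ext θ
        simp only [Set.mem_inter_iff, Set.mem_ofPred_eq, Set.mem_sdiff, Set.mem_Icc,
          and_congr_right_iff]
        intro hθ
        have harg : (Complex.polarCoord.symm (y, θ)).arg = θ := by
          rw [Complex.polarCoord_symm_apply]
          push_cast
          exact Complex.arg_mul_cos_add_sin_mul_I hy ⟨hθ.1, hθ.2.le⟩
        rw [harg, abs_le]
        simp [h]
      -- Strict positivity of `p` keeps this closed interval inside the open range of the polar
      -- angle.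
      have hsub : Set.Icc (-(Real.pi * (1 - p))) (Real.pi * (1 - p)) ⊆
          Set.Ioo (-Real.pi) Real.pi := by
        intro θ hθ
        have : 0 < Real.pi * p := mul_pos hpi hp0
        constructor <;> nlinarith [hθ.1, hθ.2]
      rw [hset, measure_sdiff hsub measurableSet_Icc.nullMeasurableSet (by simp),
        Real.volume_Ioo, Real.volume_Icc, if_pos h, ← ENNReal.ofReal_sub]
      · congr 1; ring
      · have : 0 ≤ Real.pi * (1 - p) := mul_nonneg hpi.le (by linarith)
        linarith
    · simp only [h, false_and, not_false_eq_true, Set.ofPred_true, Set.inter_univ, Real.volume_Ioo,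
        if_false]
      congr 1; ring

/-! ## Laplace transform of the interference from the full-duplex base stations -/

lemma activeProb_nonneg (x : ℝ≥0∞) : 0 ≤ activeProb x := by
  unfold activeProb
  split_ifs
  · exact zero_le_one
  · simp

lemma activeProb_le_one (x : ℝ≥0∞) : activeProb x ≤ 1 := by
  unfold activeProb
  split_ifs
  · exact le_rfl
  · linarith [Real.exp_pos (-x.toReal)]

lemma measurable_activeProb : Measurable activeProb := by
  unfold activeProb
  exact Measurable.ite (measurableSet_singleton ⊤) measurable_const (by fun_prop)

lemma one_sub_laplaceExp {w : ℝ} (hw : 0 ≤ w) : 1 - laplaceExp w = w / (1 + w) := by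
  unfold laplaceExp
  field_simp
  ring

lemma ofReal_one_sub_laplaceExp {w : ℝ} (hw : 0 ≤ w) :
    ENNReal.ofReal (1 - laplaceExp w) = 1 - (1 + ENNReal.ofReal w)⁻¹ := by
  have h : (0 : ℝ) < 1 + w := by linarith
  rw [laplaceExp, one_div, ENNReal.ofReal_sub _ (inv_nonneg.2 h.le), ENNReal.ofReal_one,
    ENNReal.ofReal_inv_of_pos h, ENNReal.ofReal_add zero_le_one hw, ENNReal.ofReal_one]

section Laplace

variable {net : Params} {Ω : Type*} [MeasurableSpace Ω] (B : BaseStations net Ω)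

instance : IsProbabilityMeasure B.μ := B.isProb

instance (γ : Fin 2 → ℝ≥0∞) (k : Fin 2) (d : Dir) (c : NodeClass) (t : Fin 2) (r : ℝ) :
    SigmaFinite (B.intensity γ k d c t r) := by
  unfold BaseStations.intensity
  exact SigmaFinite.withDensity_ofReal _

lemma BaseStations.intensity_zero_singleton (γ : Fin 2 → ℝ≥0∞) (k : Fin 2) (d : Dir)
    (c : NodeClass) (t : Fin 2) (r : ℝ) : B.intensity γ k d c t r {0} = 0 := by
  unfold BaseStations.intensity
  refine (withDensity_absolutelyContinuous _ _) ?_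
  exact Measure.restrict_le_self.absolutelyContinuous (by simp)

lemma BaseStations.lamFD_nonneg (γ : Fin 2 → ℝ≥0∞) (t : Fin 2) : 0 ≤ B.lamFD γ t :=
  mul_nonneg (div_nonneg measureReal_nonneg measureReal_nonneg) (net.lam_pos t).le

lemma Params.ratio_pos (net : Params) (t k : Fin 2) : 0 < net.ratio t k :=
  Real.rpow_pos_of_pos (div_pos (net.P_pos t) (net.P_pos k)) _

lemma Params.Δ_pos (net : Params) (k t : Fin 2) {r : ℝ} (hr : 0 < r) : 0 < net.Δ k t r :=
  mul_pos hr (net.ratio_pos t k)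

lemma Params.pI_pos (net : Params) (k t : Fin 2) : 0 < net.pI k t := by
  have h1 : 0 < net.P t ^ (1 / net.α) := Real.rpow_pos_of_pos (net.P_pos t) _
  have h2 : 0 < net.P k ^ (1 / net.α) := Real.rpow_pos_of_pos (net.P_pos k) _
  unfold Params.pI
  have h3 : net.P t ^ (1 / net.α) / (net.P t ^ (1 / net.α) + net.P k ^ (1 / net.α)) < 1 := by
    rw [div_lt_one (by positivity)]; linarith
  have h4 : 0 ≤ net.P t ^ (1 / net.α) / (net.P t ^ (1 / net.α) + net.P k ^ (1 / net.α)) := by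
    positivity
  nlinarith

lemma Params.pI_le_one (net : Params) (k t : Fin 2) : net.pI k t ≤ 1 := by
  unfold Params.pI
  nlinarith [sq_nonneg (net.P t ^ (1 / net.α) / (net.P t ^ (1 / net.α) + net.P k ^ (1 / net.α)))]

lemma BaseStations.intensityFun_bsFD_nonneg (γ : Fin 2 → ℝ≥0∞) (k : Fin 2) (d : Dir) (t : Fin 2)
    (r y : ℝ) : 0 ≤ B.intensityFun γ k d .bsFD t r y :=
  mul_nonneg (B.lamFD_nonneg γ t) (activeProb_nonneg _)

lemma BaseStations.intensityFun_bsFD_le (γ : Fin 2 → ℝ≥0∞) (k : Fin 2) (d : Dir) (t : Fin 2)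
    (r y : ℝ) : B.intensityFun γ k d .bsFD t r y ≤ B.lamFD γ t :=
  mul_le_of_le_one_right (B.lamFD_nonneg γ t) (activeProb_le_one _)

lemma BaseStations.measurable_intensityFun_bsFD (γ : Fin 2 → ℝ≥0∞) (k : Fin 2) (d : Dir)
    (t : Fin 2) (r : ℝ) : Measurable (B.intensityFun γ k d .bsFD t r) := by
  have hζ : Measurable (net.ζ k d t r) := by
    unfold Params.ζ
    cases d <;> fun_prop
  exact (measurable_activeProb.comp ((hζ.pow_const 2).const_mul _)).const_mul _

/-- The integrand `λ(y) y (1 - 1 / (1 + s P_t y ^ (-α)))` in the Laplace transform at `s` of the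
interference from full-duplex base stations. -/
def BaseStations.laplaceIntegrand (γ : Fin 2 → ℝ≥0∞) (k : Fin 2) (d : Dir) (t : Fin 2)
    (r s y : ℝ) : ℝ :=
  B.intensityFun γ k d .bsFD t r y * y * (1 - laplaceExp (s * net.P t / y ^ net.α))

lemma BaseStations.laplaceIntegrand_nonneg (γ : Fin 2 → ℝ≥0∞) (k : Fin 2) (d : Dir) (t : Fin 2)
    (r : ℝ) {s y : ℝ} (hs : 0 ≤ s) (hy : 0 ≤ y) : 0 ≤ B.laplaceIntegrand γ k d t r s y := by
  have hw : 0 ≤ s * net.P t / y ^ net.α :=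
    div_nonneg (mul_nonneg hs (net.P_pos t).le) (Real.rpow_nonneg hy _)
  refine mul_nonneg (mul_nonneg (B.intensityFun_bsFD_nonneg γ k d t r y) hy) ?_
  rw [one_sub_laplaceExp hw]
  positivity

lemma BaseStations.measurable_laplaceIntegrand (γ : Fin 2 → ℝ≥0∞) (k : Fin 2) (d : Dir)
    (t : Fin 2) (r s : ℝ) : Measurable (B.laplaceIntegrand γ k d t r s) := by
  unfold BaseStations.laplaceIntegrand laplaceExp
  have := B.measurable_intensityFun_bsFD γ k d t r
  fun_prop

/-- The integrand is at most `λ y`, which handles bounded `y`, and at most a constant times `y ^ (1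
- α)`, which is integrable at infinity because `α > 2`. -/
lemma BaseStations.integrableOn_laplaceIntegrand (γ : Fin 2 → ℝ≥0∞) (k : Fin 2) (d : Dir)
    (t : Fin 2) (r : ℝ) {s : ℝ} (hs : 0 ≤ s) :
    IntegrableOn (B.laplaceIntegrand γ k d t r s) (Set.Ioi 0) := by
  have hmeas := (B.measurable_laplaceIntegrand γ k d t r s).aestronglyMeasurable (μ := volume)
  have hlam := B.lamFD_nonneg γ t
  have hα := net.two_lt_α
  have hbound : ∀ y : ℝ, 0 < y → B.laplaceIntegrand γ k d t r s y ≤ B.lamFD γ t * y ∧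
      B.laplaceIntegrand γ k d t r s y ≤ B.lamFD γ t * (s * net.P t) * y ^ (1 - net.α) := by
    intro y hy
    have hya : 0 < y ^ net.α := Real.rpow_pos_of_pos hy _
    have hw : 0 ≤ s * net.P t / y ^ net.α :=
      div_nonneg (mul_nonneg hs (net.P_pos t).le) hya.le
    have h1 : B.intensityFun γ k d .bsFD t r y * y ≤ B.lamFD γ t * y :=
      mul_le_mul_of_nonneg_right (B.intensityFun_bsFD_le γ k d t r y) hy.le
    have h2 : 0 ≤ 1 - laplaceExp (s * net.P t / y ^ net.α) := by
      rw [one_sub_laplaceExp hw]; positivity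
    have h3 : 1 - laplaceExp (s * net.P t / y ^ net.α) ≤ 1 := by
      rw [one_sub_laplaceExp hw, div_le_one (by linarith)]; linarith
    have h4 : 1 - laplaceExp (s * net.P t / y ^ net.α) ≤ s * net.P t / y ^ net.α := by
      rw [one_sub_laplaceExp hw]; exact div_le_self hw (by linarith)
    have h5 : 0 ≤ B.lamFD γ t * y := mul_nonneg hlam hy.le
    constructor
    · calc _ ≤ (B.lamFD γ t * y) * 1 := mul_le_mul h1 h3 h2 h5
        _ = _ := mul_one _
    · calc _ ≤ (B.lamFD γ t * y) * (s * net.P t / y ^ net.α) := mul_le_mul h1 h4 h2 h5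
        _ = _ := by rw [Real.rpow_sub hy, Real.rpow_one]; ring
  rw [← Set.Ioc_union_Ioi_eq_Ioi zero_le_one]
  refine IntegrableOn.union ?_ ?_
  · refine Measure.integrableOn_of_bounded (M := B.lamFD γ t) (by simp) hmeas ?_
    filter_upwards [ae_restrict_mem measurableSet_Ioc] with y hy
    rw [Real.norm_of_nonneg (B.laplaceIntegrand_nonneg γ k d t r hs hy.1.le)]
    exact (hbound y hy.1).1.trans (mul_le_of_le_one_right hlam hy.2)
  · refine Integrable.mono' ((integrableOn_Ioi_rpow_of_lt (a := 1 - net.α) (by linarith)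
      one_pos).const_mul (B.lamFD γ t * (s * net.P t))) hmeas.restrict ?_
    filter_upwards [ae_restrict_mem measurableSet_Ioi] with y hy
    have hy0 : (0 : ℝ) < y := one_pos.trans hy
    rw [Real.norm_of_nonneg (B.laplaceIntegrand_nonneg γ k d t r hs hy0.le)]
    exact (hbound y hy0).2

/-- The integrand and the density are radial, so only the angular measure of the region enters.
Integrability of the radial integrand makes the result a real integral, hence finite. -/
lemma BaseStations.lintegral_intensity_bsFD (γ : Fin 2 → ℝ≥0∞) (k : Fin 2) (d : Dir) (t : Fin 2)
    (r : ℝ) {s : ℝ} (hs : 0 ≤ s) (hr : 0 < r) :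
    ∫⁻ z, (1 - (1 + net.gain (ENNReal.ofReal s) .bsFD t z)⁻¹) ∂B.intensity γ k d .bsFD t r =
      match d with
      | .down => ENNReal.ofReal
          (2 * Real.pi * ∫ y in Set.Ioi (net.Δ k t r), B.laplaceIntegrand γ k .down t r s y)
      | .up => ENNReal.ofReal
          (2 * Real.pi * net.pI k t *
              (∫ y in Set.Ioc 0 (net.Δ k t r + r), B.laplaceIntegrand γ k .up t r s y) +
            2 * Real.pi * ∫ y in Set.Ioi (net.Δ k t r + r), B.laplaceIntegrand γ k .up t r s y) := by
  have hpi := Real.pi_pos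
  set G : ℝ → ℝ≥0∞ := fun y => ENNReal.ofReal (B.intensityFun γ k d .bsFD t r y) *
    (1 - (1 + ENNReal.ofReal s * (ENNReal.ofReal (net.P t) * ENNReal.ofReal y ^ (-net.α)))⁻¹)
    with hG
  have him := B.measurable_intensityFun_bsFD γ k d t r
  have hGm : Measurable G := by
    have : Measurable fun y : ℝ =>
        1 + ENNReal.ofReal s * (ENNReal.ofReal (net.P t) * ENNReal.ofReal y ^ (-net.α)) := by
      fun_prop
    exact him.ennreal_ofReal.mul (measurable_const.sub this.inv)
  have hGy : ∀ y : ℝ, 0 < y →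
      ENNReal.ofReal y * G y = ENNReal.ofReal (B.laplaceIntegrand γ k d t r s y) := by
    intro y hy
    have hya : 0 < y ^ net.α := Real.rpow_pos_of_pos hy _
    have hw : 0 ≤ s * net.P t / y ^ net.α :=
      div_nonneg (mul_nonneg hs (net.P_pos t).le) hya.le
    have hgain : ENNReal.ofReal s * (ENNReal.ofReal (net.P t) * ENNReal.ofReal y ^ (-net.α)) =
        ENNReal.ofReal (s * net.P t / y ^ net.α) := by
      rw [ENNReal.ofReal_rpow_of_pos hy, ← ENNReal.ofReal_mul (net.P_pos t).le,
        ← ENNReal.ofReal_mul hs, Real.rpow_neg hy.le]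
      congr 1; ring
    simp only [hG]
    rw [hgain, ← ofReal_one_sub_laplaceExp hw,
      ← ENNReal.ofReal_mul (B.intensityFun_bsFD_nonneg γ k d t r y), ← ENNReal.ofReal_mul hy.le,
      BaseStations.laplaceIntegrand]
    congr 1; ring
  have hint : ∀ S : Set ℝ, MeasurableSet S → S ⊆ Set.Ioi 0 →
      ∫⁻ y in S, ENNReal.ofReal y * G y =
        ENNReal.ofReal (∫ y in S, B.laplaceIntegrand γ k d t r s y) ∧
      0 ≤ ∫ y in S, B.laplaceIntegrand γ k d t r s y := by
    intro S hS hS0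
    have hnn : ∀ y ∈ S, 0 ≤ B.laplaceIntegrand γ k d t r s y := fun y hy =>
      B.laplaceIntegrand_nonneg γ k d t r hs (le_of_lt (hS0 hy))
    refine ⟨?_, setIntegral_nonneg hS hnn⟩
    rw [ofReal_integral_eq_lintegral_ofReal ((B.integrableOn_laplaceIntegrand γ k d t r hs).mono_set
      hS0) ((ae_restrict_iff' hS).2 (ae_of_all _ hnn))]
    exact setLIntegral_congr_fun hS fun y hy => hGy y (hS0 hy)
  have hstep : ∫⁻ z, (1 - (1 + net.gain (ENNReal.ofReal s) .bsFD t z)⁻¹)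
      ∂B.intensity γ k d .bsFD t r = ∫⁻ z in net.region γ k d .bsFD t r, G ‖z‖ := by
    unfold BaseStations.intensity
    have h1 : Measurable fun z : ℂ => ENNReal.ofReal (B.intensityFun γ k d .bsFD t r ‖z‖) :=
      (him.comp measurable_norm).ennreal_ofReal
    have h2 : Measurable fun z => 1 - (1 + net.gain (ENNReal.ofReal s) .bsFD t z)⁻¹ :=
      measurable_const.sub (measurable_const.add (net.measurable_gain _ _ t)).inv
    rw [lintegral_withDensity_eq_lintegral_mul _ h1 h2]
    rfl
  have hΔ := net.Δ_pos k t hr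
  rw [hstep]
  cases d with
  | down =>
    obtain ⟨h1, h2⟩ := hint (Set.Ioi (net.Δ k t r)) measurableSet_Ioi
      (Set.Ioi_subset_Ioi hΔ.le)
    refine (lintegral_radial_of_le_norm hΔ.le hGm).trans ?_
    rw [h1, ← ENNReal.ofReal_mul (by positivity)]
  | up =>
    have hp := net.pI_pos k t
    obtain ⟨h1, h2⟩ := hint (Set.Ioi (net.Δ k t r + r)) measurableSet_Ioi
      (Set.Ioi_subset_Ioi (by positivity))
    obtain ⟨h3, h4⟩ := hint (Set.Ioc 0 (net.Δ k t r + r)) measurableSet_Ioc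
      (fun y hy => hy.1)
    refine (lintegral_radial_compl_sector (by positivity) hp (net.pI_le_one k t) hGm).trans ?_
    rw [h1, h3, ← ENNReal.ofReal_mul (by positivity), ← ENNReal.ofReal_mul (by positivity),
      ← ENNReal.ofReal_add (by positivity) (by positivity)]

lemma BaseStations.lintegral_intensity_bsFD_ne_top (γ : Fin 2 → ℝ≥0∞) (k : Fin 2) (d : Dir)
    (t : Fin 2) {r : ℝ} (hr : 0 < r) :
    ∫⁻ z, (1 - (1 + net.gain 1 .bsFD t z)⁻¹) ∂B.intensity γ k d .bsFD t r ≠ ⊤ := by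
  have h := B.lintegral_intensity_bsFD γ k d t r zero_le_one hr
  rw [ENNReal.ofReal_one] at h
  rw [h]
  cases d <;> exact ENNReal.ofReal_ne_top

lemma BaseStations.expNeg_lintegral_intensity_bsFD (k : Fin 2) (d : Dir) (t : Fin 2) {r T : ℝ}
    (hr : 0 < r) (hT : 0 ≤ T) :
    expNeg (∫⁻ z, (1 - (1 + net.gain (ENNReal.ofReal (T * r ^ net.α / net.sigPower k d))
      .bsFD t z)⁻¹) ∂B.intensity 0 k d .bsFD t r) = ENNReal.ofReal (B.laplaceBS k d t r T) := by
  have hpi := Real.pi_pos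
  have hs : 0 ≤ T * r ^ net.α / net.sigPower k d := by
    have := net.sigPower_pos k d
    positivity
  have harg : ∀ y, net.P t * T * r ^ net.α / (net.sigPower k d * y ^ net.α) =
      T * r ^ net.α / net.sigPower k d * net.P t / y ^ net.α := fun y => by
    rw [div_mul_eq_mul_div, div_div]; ring
  have hnn : ∀ S : Set ℝ, MeasurableSet S → S ⊆ Set.Ioi 0 →
      0 ≤ ∫ y in S, B.laplaceIntegrand 0 k d t r (T * r ^ net.α / net.sigPower k d) y :=
    fun S hS hS0 => setIntegral_nonneg hS fun y hy =>
      B.laplaceIntegrand_nonneg 0 k d t r hs (le_of_lt (hS0 hy))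
  have hΔ := net.Δ_pos k t hr
  have hp := net.pI_pos k t
  rw [B.lintegral_intensity_bsFD 0 k d t r hs hr]
  cases d with
  | down =>
    have h1 := hnn (Set.Ioi (net.Δ k t r)) measurableSet_Ioi (Set.Ioi_subset_Ioi hΔ.le)
    simp only
    rw [expNeg_ofReal (by positivity)]
    unfold BaseStations.laplaceBS BaseStations.laplaceIntegrand
    simp only [← harg]
    congr 2
    simp only [Params.sigPower]
    ring
  | up =>
    have h1 := hnn (Set.Ioi (net.Δ k t r + r)) measurableSet_Ioi
      (Set.Ioi_subset_Ioi (by positivity))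
    have h2 := hnn (Set.Ioc 0 (net.Δ k t r + r)) measurableSet_Ioc (fun y hy => hy.1)
    simp only
    rw [expNeg_ofReal (by positivity)]
    unfold BaseStations.laplaceBS BaseStations.laplaceIntegrand
    simp only [← harg]
    congr 2
    simp only [Params.sigPower]
    ring

end Laplace

/-! ## The law of the distance to the serving base station -/

lemma measurable_nearest : Measurable Config.nearest := by
  refine Measurable.iInf fun n => ?_
  exact Measurable.ite (measurableSet_lt_card n) (measurable_point n).norm.ennreal_ofReal
    measurable_const

/-- Reduces the law of the nearest distance to void probabilities; the open ball matches the
non-strict inequality. -/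
lemma Config.le_nearest_iff (x : Config) (a : ℝ) :
    ENNReal.ofReal a ≤ x.nearest ↔ x.count (Metric.ball 0 a) = 0 := by
  classical
  rw [Config.nearest, le_iInf_iff, Config.count, ENNReal.tsum_eq_zero]
  refine forall_congr' fun n => ?_
  by_cases h : (n : ℕ∞) < x.1
  · simp [h, ENNReal.ofReal_le_ofReal_iff (norm_nonneg _), -ofReal_norm]
  · simp [h]

/-- The law with tail `exp (-π lam a²)`, that of the distance from the origin to the closest point
of a homogeneous Poisson process of density `lam`. -/
def contactLaw (lam : ℝ) : Measure ℝ :=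
  (volume.restrict (Set.Ioi 0)).withDensity fun r =>
    ENNReal.ofReal (2 * Real.pi * lam * r * Real.exp (-Real.pi * lam * r ^ 2))

lemma contactLaw_Ici {lam a : ℝ} (hlam : 0 < lam) (ha : 0 ≤ a) :
    contactLaw lam (Set.Ici a) = ENNReal.ofReal (Real.exp (-Real.pi * lam * a ^ 2)) := by
  have hpi := Real.pi_pos
  have hderiv : ∀ x ∈ Set.Ici a, HasDerivAt (fun r => -Real.exp (-Real.pi * lam * r ^ 2))
      (2 * Real.pi * lam * x * Real.exp (-Real.pi * lam * x ^ 2)) x := by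
    intro x _
    have h1 : HasDerivAt (fun r : ℝ => -Real.pi * lam * r ^ 2) (-Real.pi * lam * (2 * x)) x := by
      simpa using (hasDerivAt_pow 2 x).const_mul (-Real.pi * lam)
    refine h1.exp.neg.congr_deriv ?_
    ring
  have hnn : ∀ x ∈ Set.Ioi a, 0 ≤ 2 * Real.pi * lam * x * Real.exp (-Real.pi * lam * x ^ 2) := by
    intro x hx
    have : 0 ≤ x := ha.trans (le_of_lt hx)
    positivity
  have hlim : Tendsto (fun r => -Real.exp (-Real.pi * lam * r ^ 2)) atTop (𝓝 0) := by
    have h1 : Tendsto (fun r : ℝ => Real.pi * lam * r ^ 2) atTop atTop :=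
      (tendsto_pow_atTop two_ne_zero).const_mul_atTop (by positivity)
    have h2 := (Real.tendsto_exp_neg_atTop_nhds_zero.comp h1).neg
    simpa [Function.comp_def] using h2
  rw [contactLaw, withDensity_apply _ measurableSet_Ici,
    Measure.restrict_congr_set
      (Ioi_ae_eq_Ici (μ := volume.restrict (Set.Ioi (0 : ℝ))) (a := a)).symm,
    Measure.restrict_restrict measurableSet_Ioi, Set.inter_eq_left.2 (Set.Ioi_subset_Ioi ha),
    ← ofReal_integral_eq_lintegral_ofReal (integrableOn_Ioi_deriv_of_nonneg' hderiv hnn hlim)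
      ((ae_restrict_iff' measurableSet_Ioi).2 (ae_of_all _ hnn)),
    integral_Ioi_of_hasDerivAt_of_nonneg' hderiv hnn hlim]
  simp

lemma contactLaw_univ {lam : ℝ} (hlam : 0 < lam) : contactLaw lam Set.univ = 1 := by
  have h := contactLaw_Ici hlam le_rfl
  have h0 : contactLaw lam (Set.Ici 0)ᶜ = 0 := by
    rw [contactLaw, withDensity_apply _ measurableSet_Ici.compl,
      Measure.restrict_restrict measurableSet_Ici.compl]
    have : (Set.Ici (0 : ℝ))ᶜ ∩ Set.Ioi 0 = ∅ := by
      ext x; simp only [Set.mem_inter_iff, Set.mem_compl_iff, Set.mem_Ici, Set.mem_Ioi,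
        Set.mem_empty_iff_false, iff_false]; intro ⟨h1, h2⟩; exact h1 h2.le
    rw [this, Measure.restrict_empty, lintegral_zero_measure]
  rw [← measure_add_measure_compl (measurableSet_Ici (a := (0 : ℝ))), h, h0]
  simp

section Association

variable {net : Params} {Ω : Type*} [MeasurableSpace Ω] (B : BaseStations net Ω)

lemma BaseStations.measurable_dist (k : Fin 2) : Measurable (B.dist k) :=
  measurable_nearest.comp (B.poisson k).measurable

lemma BaseStations.measure_le_dist (k : Fin 2) {a : ℝ} (ha : 0 ≤ a) :
    B.μ {ω | ENNReal.ofReal a ≤ B.dist k ω} =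
      ENNReal.ofReal (Real.exp (-Real.pi * net.lam k * a ^ 2)) := by
  have hlam := net.lam_pos k
  have hpi := Real.pi_pos
  have hvol : (ENNReal.ofReal (net.lam k) • volume) (Metric.ball (0 : ℂ) a) =
      ENNReal.ofReal (Real.pi * net.lam k * a ^ 2) := by
    rw [Measure.smul_apply, Complex.volume_ball, smul_eq_mul, ← ENNReal.ofReal_pow ha,
      ← ENNReal.ofReal_coe_nnreal, NNReal.coe_real_pi, ← ENNReal.ofReal_mul (by positivity),
      ← ENNReal.ofReal_mul hlam.le]
    congr 1; ring
  have h := (B.poisson k).count_law (Metric.ball 0 a) measurableSet_ball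
    (by rw [hvol]; exact ENNReal.ofReal_ne_top) 0
  rw [poissonMeasure_singleton, hvol] at h
  simp only [BaseStations.dist, Config.le_nearest_iff]
  rw [Nat.cast_zero] at h
  rw [h, ENNReal.coe_toNNReal_eq_toReal, ENNReal.toReal_ofReal (by positivity)]
  simp

lemma BaseStations.ae_dist_ne_top (k : Fin 2) : ∀ᵐ ω ∂B.μ, B.dist k ω ≠ ⊤ := by
  rw [ae_iff]
  simp only [not_not]
  have hle : ∀ n : ℕ, B.μ {ω | B.dist k ω = ⊤} ≤
      ENNReal.ofReal (Real.exp (-Real.pi * net.lam k * (n : ℝ) ^ 2)) := by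
    intro n
    rw [← B.measure_le_dist k n.cast_nonneg]
    refine measure_mono fun ω hω => ?_
    have : B.dist k ω = ⊤ := hω
    simp [this]
  have hlim : Tendsto (fun n : ℕ => ENNReal.ofReal (Real.exp (-Real.pi * net.lam k * (n : ℝ) ^ 2)))
      atTop (𝓝 0) := by
    rw [← ENNReal.ofReal_zero]
    refine ENNReal.tendsto_ofReal ?_
    have h1 : Tendsto (fun n : ℕ => Real.pi * net.lam k * (n : ℝ) ^ 2) atTop atTop :=
      ((tendsto_pow_atTop two_ne_zero).comp tendsto_natCast_atTop_atTop).const_mul_atTop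
        (mul_pos Real.pi_pos (net.lam_pos k))
    simpa [Function.comp_def] using Real.tendsto_exp_neg_atTop_nhds_zero.comp h1
  exact le_antisymm (ge_of_tendsto' hlim hle) zero_le

lemma BaseStations.map_dist (k : Fin 2) :
    B.μ.map (fun ω => (B.dist k ω).toReal) = contactLaw (net.lam k) := by
  have hm : Measurable fun ω => (B.dist k ω).toReal := (B.measurable_dist k).ennreal_toReal
  have hfin : IsFiniteMeasure (contactLaw (net.lam k)) :=
    ⟨by rw [contactLaw_univ (net.lam_pos k)]; exact ENNReal.one_lt_top⟩
  have hprob := Measure.isProbabilityMeasure_map (μ := B.μ) hm.aemeasurable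
  refine Measure.ext_of_Ici _ _ fun a => ?_
  have hval : ∀ a : ℝ, 0 ≤ a → B.μ.map (fun ω => (B.dist k ω).toReal) (Set.Ici a) =
      contactLaw (net.lam k) (Set.Ici a) := by
    intro a ha
    rw [contactLaw_Ici (net.lam_pos k) ha, ← B.measure_le_dist k ha,
      Measure.map_apply hm measurableSet_Ici]
    refine measure_congr ?_
    filter_upwards [B.ae_dist_ne_top k] with ω hω
    -- An infinite distance would be read as `0` by `toReal`, so its exclusion almost surely is
    -- essential here.
    exact propext (ENNReal.ofReal_le_iff_le_toReal hω).symm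
  rcases le_or_gt 0 a with ha | ha
  · exact hval a ha
  · have h0 := hval 0 le_rfl
    rw [contactLaw_Ici (net.lam_pos k) le_rfl] at h0
    have h1 : contactLaw (net.lam k) (Set.Ici 0) = 1 := by
      rw [contactLaw_Ici (net.lam_pos k) le_rfl]; simp
    have hsub : Set.Ici (0 : ℝ) ⊆ Set.Ici a := Set.Ici_subset_Ici.2 ha.le
    refine (le_antisymm prob_le_one ?_).trans (le_antisymm ?_ ?_).symm
    · calc (1 : ℝ≥0∞) = B.μ.map (fun ω => (B.dist k ω).toReal) (Set.Ici 0) := by rw [h0]; simp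
        _ ≤ _ := measure_mono hsub
    · rw [← contactLaw_univ (net.lam_pos k)]; exact measure_mono (Set.subset_univ _)
    · rw [← h1]; exact measure_mono hsub

lemma BaseStations.ae_dist_pos (k : Fin 2) : ∀ᵐ ω ∂B.μ, 0 < (B.dist k ω).toReal := by
  have hm : Measurable fun ω => (B.dist k ω).toReal := (B.measurable_dist k).ennreal_toReal
  have h : ∀ᵐ r ∂B.μ.map (fun ω => (B.dist k ω).toReal), 0 < r := by
    rw [B.map_dist k]
    refine (withDensity_absolutelyContinuous _ _).ae_le ?_
    filter_upwards [ae_restrict_mem measurableSet_Ioi] with r hr using hr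
  exact ae_of_ae_map hm.aemeasurable h

lemma BaseStations.indepFun_dist (k : Fin 2) :
    IndepFun (fun ω => (B.dist k ω).toReal) (fun ω => (B.dist k.rev ω).toReal) B.μ := by
  have hm : Measurable fun x : Config => x.nearest.toReal := measurable_nearest.ennreal_toReal
  fin_cases k
  · exact B.indep.comp hm hm
  · exact (B.indep.comp hm hm).symm

/-- Distances are almost surely neither `0` nor `∞`, so the received power is a genuine real number.
Its finiteness is also what rules out full-duplex users at the thresholds `∞`. -/
lemma BaseStations.ae_power_eq (k : Fin 2) : ∀ᵐ ω ∂B.μ,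
    B.power k ω = ENNReal.ofReal (net.P k * (B.dist k ω).toReal ^ (-net.α)) := by
  filter_upwards [B.ae_dist_ne_top k, B.ae_dist_pos k] with ω h1 h2
  rw [BaseStations.power, ENNReal.ofReal_mul (net.P_pos k).le, ← ENNReal.ofReal_rpow_of_pos h2,
    ENNReal.ofReal_toReal h1]

lemma Params.power_le_power_iff (net : Params) (k : Fin 2) {d d' : ℝ} (hd : 0 < d) (hd' : 0 < d') :
    net.P k.rev * d' ^ (-net.α) ≤ net.P k * d ^ (-net.α) ↔ net.mu k d ≤ d' := by
  have hα : 0 < net.α := by linarith [net.two_lt_α]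
  have hP := net.P_pos k
  have hP' := net.P_pos k.rev
  have h1 : 0 < d ^ net.α := Real.rpow_pos_of_pos hd _
  have h2 : 0 < d' ^ net.α := Real.rpow_pos_of_pos hd' _
  have hmu : 0 ≤ net.mu k d := mul_nonneg hd.le (net.ratio_pos _ _).le
  have hmu' : net.mu k d ^ net.α = d ^ net.α * (net.P k.rev / net.P k) := by
    rw [Params.mu, Params.ratio, Real.mul_rpow hd.le (by positivity), ← Real.rpow_mul
      (by positivity), one_div, inv_mul_cancel₀ hα.ne', Real.rpow_one]
  rw [← Real.rpow_le_rpow_iff hmu hd'.le hα, hmu', Real.rpow_neg hd.le, Real.rpow_neg hd'.le,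
    ← div_eq_mul_inv, ← div_eq_mul_inv, div_le_div_iff₀ h2 h1, ← mul_div_assoc,
    div_le_iff₀ hP]
  constructor <;> intro h <;> linarith

lemma BaseStations.ae_mem_inTier_iff (k : Fin 2) : ∀ᵐ ω ∂B.μ,
    (ω ∈ B.inTier k ↔ net.mu k (B.dist k ω).toReal ≤ (B.dist k.rev ω).toReal) := by
  filter_upwards [B.ae_power_eq k, B.ae_power_eq k.rev, B.ae_dist_pos k, B.ae_dist_pos k.rev]
    with ω h1 h2 h3 h4
  change B.power k.rev ω ≤ B.power k ω ↔ _
  rw [h1, h2, ENNReal.ofReal_le_ofReal_iff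
    (mul_nonneg (net.P_pos k).le (Real.rpow_nonneg h3.le _)), net.power_le_power_iff k h3 h4]

lemma BaseStations.measurable_power (k : Fin 2) : Measurable (B.power k) :=
  ((B.measurable_dist k).pow_const _).const_mul _

lemma Params.F_nonneg (net : Params) (k : Fin 2) {r : ℝ} (hr : 0 ≤ r) : 0 ≤ net.F k r :=
  mul_nonneg hr (Real.exp_nonneg _)

lemma Params.measurable_F (net : Params) (k : Fin 2) : Measurable (net.F k) := by
  unfold Params.F Params.mu
  fun_prop

/-- The law of the distance to the serving base station, on the event of association to tier `k`. -/
lemma BaseStations.map_restrict_inTier (k : Fin 2) :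
    (B.μ.restrict (B.inTier k)).map (fun ω => (B.dist k ω).toReal) =
      (volume.restrict (Set.Ioi 0)).withDensity fun r =>
        ENNReal.ofReal (2 * Real.pi * net.lam k * net.F k r) := by
  have hpi := Real.pi_pos
  have hlam := net.lam_pos k
  have hm : ∀ k, Measurable fun ω => (B.dist k ω).toReal := fun k =>
    (B.measurable_dist k).ennreal_toReal
  have hmu : Measurable (net.mu k) := by unfold Params.mu; fun_prop
  have hfin : ∀ k, SFinite (contactLaw (net.lam k)) := fun k => by
    unfold contactLaw; infer_instance
  refine Measure.ext fun S hS => ?_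
  set A : Set (ℝ × ℝ) := {p | p.1 ∈ S ∧ net.mu k p.1 ≤ p.2} with hA
  have hAm : MeasurableSet A := (measurable_fst hS).inter
    (measurableSet_le (hmu.comp measurable_fst) measurable_snd)
  have hmap := (B.indepFun_dist k).map_prod_eq_prod_map_map (hm k).aemeasurable
    (hm k.rev).aemeasurable
  rw [B.map_dist, B.map_dist] at hmap
  calc (B.μ.restrict (B.inTier k)).map (fun ω => (B.dist k ω).toReal) S
      = B.μ ((fun ω => (B.dist k ω).toReal) ⁻¹' S ∩ B.inTier k) := by
        rw [Measure.map_apply (hm k) hS, Measure.restrict_apply ((hm k) hS)]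
    _ = B.μ.map (fun ω => ((B.dist k ω).toReal, (B.dist k.rev ω).toReal)) A := by
        rw [Measure.map_apply ((hm k).prodMk (hm k.rev)) hAm]
        refine measure_congr ?_
        filter_upwards [B.ae_mem_inTier_iff k] with ω hω
        exact propext (and_congr_right fun _ => hω)
    -- The two distances are independent; given `D_k = r`, association requires the other distance
    -- to be at least `μ_k(r)`, and this tail is the second Gaussian factor of `F`.
    _ = ∫⁻ r in S, contactLaw (net.lam k.rev) (Set.Ici (net.mu k r)) ∂contactLaw (net.lam k) := by
        rw [hmap, Measure.prod_apply hAm, ← lintegral_indicator hS]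
        refine lintegral_congr fun r => ?_
        by_cases h : r ∈ S
        · rw [Set.indicator_of_mem h]
          congr 1; ext y; simp [hA, h]
        · rw [Set.indicator_of_notMem h]
          have : Prod.mk r ⁻¹' A = ∅ := by ext y; simp [hA, h]
          rw [this, measure_empty]
    _ = _ := by
        have hae : ∀ᵐ r ∂contactLaw (net.lam k), 0 < r := by
          refine (withDensity_absolutelyContinuous _ _).ae_le ?_
          filter_upwards [ae_restrict_mem measurableSet_Ioi] with r hr using hr
        have hdm : Measurable fun r : ℝ => ENNReal.ofReal
            (2 * Real.pi * net.lam k * r * Real.exp (-Real.pi * net.lam k * r ^ 2)) := by fun_prop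
        have hem : Measurable fun r : ℝ => ENNReal.ofReal
            (Real.exp (-Real.pi * net.lam k.rev * net.mu k r ^ 2)) := by fun_prop
        rw [lintegral_congr_ae (g := fun r => ENNReal.ofReal
          (Real.exp (-Real.pi * net.lam k.rev * net.mu k r ^ 2)))]
        · rw [contactLaw, restrict_withDensity hS, lintegral_withDensity_eq_lintegral_mul _ hdm hem,
            withDensity_apply _ hS, Measure.restrict_restrict hS]
          refine setLIntegral_congr_fun (hS.inter measurableSet_Ioi) fun r hr => ?_
          have hr0 : (0 : ℝ) < r := hr.2
          simp only [Pi.mul_apply]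
          rw [← ENNReal.ofReal_mul (by positivity), Params.F, sub_eq_add_neg, Real.exp_add]
          congr 1
          rw [show -(Real.pi * net.lam k.rev * net.mu k r ^ 2) =
            -Real.pi * net.lam k.rev * net.mu k r ^ 2 by ring]
          ring
        · filter_upwards [ae_restrict_of_ae hae] with r hr
          exact contactLaw_Ici (net.lam_pos _) (mul_nonneg hr.le (net.ratio_pos _ _).le)

lemma BaseStations.inTierFD_zero (k : Fin 2) : B.inTierFD 0 k = B.inTier k := by
  simp [BaseStations.inTierFD]

lemma BaseStations.inTierHD_zero (k : Fin 2) : B.inTierHD 0 k = ∅ := by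
  simp [BaseStations.inTierHD]

lemma BaseStations.inTierHD_top (k : Fin 2) : B.inTierHD ⊤ k =ᵐ[B.μ] B.inTier k := by
  filter_upwards [B.ae_power_eq k] with ω hω
  refine propext ⟨fun h => h.1, fun h => ⟨h, ?_⟩⟩
  rw [hω]
  exact ENNReal.ofReal_lt_top

lemma BaseStations.measure_inTierFD_top (k : Fin 2) : B.μ (B.inTierFD ⊤ k) = 0 := by
  refine measure_mono_null (t := {ω | ¬ B.power k ω =
    ENNReal.ofReal (net.P k * (B.dist k ω).toReal ^ (-net.α))}) (fun ω hω h => ?_)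
    (ae_iff.1 (B.ae_power_eq k))
  have h1 : (⊤ : ℝ≥0∞) ≤ B.power k ω := hω.2
  rw [h] at h1
  exact ENNReal.ofReal_ne_top (top_le_iff.1 h1)

lemma BaseStations.AFD_zero (k : Fin 2) : B.AFD 0 k = B.A k := by
  rw [BaseStations.AFD, B.inTierFD_zero, BaseStations.A]

lemma BaseStations.AHD_zero (k : Fin 2) : B.AHD 0 k = 0 := by
  rw [BaseStations.AHD, B.inTierHD_zero, measureReal_empty]

lemma BaseStations.AFD_top (k : Fin 2) : B.AFD ⊤ k = 0 := by
  rw [BaseStations.AFD, Measure.real, B.measure_inTierFD_top, ENNReal.toReal_zero]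

lemma BaseStations.AHD_top (k : Fin 2) : B.AHD ⊤ k = B.A k := by
  rw [BaseStations.AHD, BaseStations.A, measureReal_congr (B.inTierHD_top k)]

lemma BaseStations.lawHD_top (k : Fin 2) : B.lawHD ⊤ k = B.lawFD 0 k := by
  rw [BaseStations.lawHD, BaseStations.lawFD, B.inTierFD_zero, ProbabilityTheory.cond,
    ProbabilityTheory.cond, measure_congr (B.inTierHD_top k),
    Measure.restrict_congr_set (B.inTierHD_top k)]

lemma BaseStations.lawFD_zero (k : Fin 2) :
    B.lawFD 0 k = (volume.restrict (Set.Ioi 0)).withDensity fun r =>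
      ENNReal.ofReal (2 * Real.pi * net.lam k / B.A k * net.F k r) := by
  rw [BaseStations.lawFD, B.inTierFD_zero]
  -- If the association probability were `0`, conditioning would yield the zero measure and division
  -- by zero the zero density, so the two sides agree without proving it positive.
  rcases eq_or_ne (B.μ (B.inTier k)) 0 with h | h
  · rw [cond_eq_zero_of_meas_eq_zero h, Measure.map_zero]
    simp [BaseStations.A, Measure.real, h]
  · have hA : 0 < B.A k := ENNReal.toReal_pos h (measure_ne_top _ _)
    have hm : Measurable fun r => ENNReal.ofReal (2 * Real.pi * net.lam k * net.F k r) :=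
      ((net.measurable_F k).const_mul _).ennreal_ofReal
    rw [ProbabilityTheory.cond, Measure.map_smul, B.map_restrict_inTier, ← withDensity_smul _ hm]
    congr 1
    ext r
    have : (B.μ (B.inTier k))⁻¹ = ENNReal.ofReal (B.A k)⁻¹ := by
      rw [ENNReal.ofReal_inv_of_pos hA, BaseStations.A, ofReal_measureReal]
    rw [Pi.smul_apply, smul_eq_mul, this, ← ENNReal.ofReal_mul (inv_nonneg.2 hA.le)]
    congr 1
    ring

end Association

/-! ## The interfering classes at the thresholds `0` and `∞` -/

section Thresholds

variable {net : Params} {Ω : Type*} [MeasurableSpace Ω] (B : BaseStations net Ω)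

lemma BaseStations.intensity_eq_zero {γ : Fin 2 → ℝ≥0∞} {k : Fin 2} {d : Dir} {c : NodeClass}
    {t : Fin 2} {r : ℝ} (h : ∀ y, B.intensityFun γ k d c t r y = 0) :
    B.intensity γ k d c t r = 0 := by
  simp [BaseStations.intensity, h]

lemma BaseStations.intensity_bsHD_zero (k : Fin 2) (d : Dir) (t : Fin 2) (r : ℝ) :
    B.intensity 0 k d .bsHD t r = 0 :=
  B.intensity_eq_zero fun y => by
    simp [BaseStations.intensityFun, BaseStations.lamHD, B.AHD_zero]

lemma BaseStations.intensity_userHD_zero (k : Fin 2) (d : Dir) (t : Fin 2) (r : ℝ) :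
    B.intensity 0 k d .userHD t r = 0 :=
  B.intensity_eq_zero fun y => by
    simp [BaseStations.intensityFun, BaseStations.lamHD, B.AHD_zero]

lemma BaseStations.intensity_bsFD_top (k : Fin 2) (d : Dir) (t : Fin 2) (r : ℝ) :
    B.intensity ⊤ k d .bsFD t r = 0 :=
  B.intensity_eq_zero fun y => by
    simp [BaseStations.intensityFun, BaseStations.lamFD, B.AFD_top]

lemma BaseStations.intensity_userFD_top (k : Fin 2) (d : Dir) (t : Fin 2) (r : ℝ) :
    B.intensity ⊤ k d .userFD t r = 0 :=
  B.intensity_eq_zero fun y => by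
    simp [BaseStations.intensityFun, BaseStations.lamFD, B.AFD_top]

/-- The source of the factor two. Infinite thresholds give `δ = 0`, so the correction to `ζ²`
disappears, and `A_t^HD = A_t` makes the base densities agree; the downlink regions of the two
classes coincide by definition. -/
lemma BaseStations.intensity_bsHD_top (k : Fin 2) (t : Fin 2) (r : ℝ) :
    B.intensity ⊤ k .down .bsHD t r = B.intensity 0 k .down .bsFD t r := by
  have hδ : net.δ ⊤ t = 0 := by
    have : 0 < 1 / net.α := by have := net.two_lt_α; positivity
    rw [Params.δ, Pi.top_apply, ENNReal.div_top, ENNReal.zero_rpow_of_pos this]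
  have hlam : B.lamHD ⊤ t = B.lamFD 0 t := by
    rw [BaseStations.lamHD, BaseStations.lamFD, B.AHD_top, B.AFD_zero]
  have hfun : ∀ y, B.intensityFun ⊤ k .down .bsHD t r y = B.intensityFun 0 k .down .bsFD t r y := by
    intro y
    simp only [BaseStations.intensityFun, hδ, hlam]
    split_ifs with h
    -- The cut-off `ζ ≤ δ = 0` leaves only `ζ = 0`, where the activity probability is `0` anyway.
    · simp [le_antisymm h zero_le, activeProb]
    · simp
  simp only [BaseStations.intensity, hfun]
  rfl

variable {B} {γ : Fin 2 → ℝ≥0∞} {k : Fin 2} {d : Dir} {Ω' : Type*} [MeasurableSpace Ω']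

lemma Link.ae_classInterference_eq_zero (L : Link B γ k d Ω') {r : ℝ} (hr : 0 < r) {c : NodeClass}
    {t : Fin 2} (h : B.intensity γ k d c t r = 0) :
    ∀ᵐ ω ∂L.κ r, L.classInterference c t ω = 0 := by
  have hX := L.nodes_poisson r hr c t
  rw [h] at hX
  filter_upwards [hX.ae_card_eq_zero] with ω hω
  simp [Link.classInterference, hω]

/-- The channels differ only in their half-duplex class, and both such classes are empty here; hence
the result does not depend on `i`. -/
lemma Link.ae_interference_zero (L : Link B 0 k d Ω') {r : ℝ} (hr : 0 < r) (i : Fin 2) :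
    ∀ᵐ ω ∂L.κ r, ∑ t, L.interference false i t ω = ∑ t, L.classInterference .bsFD t ω := by
  have h1 : ∀ᵐ ω ∂L.κ r, ∀ t, L.classInterference .bsHD t ω = 0 := ae_all_iff.2 fun t =>
    L.ae_classInterference_eq_zero hr (B.intensity_bsHD_zero k d t r)
  have h2 : ∀ᵐ ω ∂L.κ r, ∀ t, L.classInterference .userHD t ω = 0 := ae_all_iff.2 fun t =>
    L.ae_classInterference_eq_zero hr (B.intensity_userHD_zero k d t r)
  filter_upwards [h1, h2] with ω h1 h2
  simp [Link.interference, h1, h2]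

lemma Link.ae_interference_top (L : Link B ⊤ k d Ω') {r : ℝ} (hr : 0 < r) :
    ∀ᵐ ω ∂L.κ r, ∑ t, L.interference true 0 t ω = ∑ t, L.classInterference .bsHD t ω := by
  have h1 : ∀ᵐ ω ∂L.κ r, ∀ t, L.classInterference .bsFD t ω = 0 := ae_all_iff.2 fun t =>
    L.ae_classInterference_eq_zero hr (B.intensity_bsFD_top k d t r)
  have h2 : ∀ᵐ ω ∂L.κ r, ∀ t, L.classInterference .userFD t ω = 0 := ae_all_iff.2 fun t =>
    L.ae_classInterference_eq_zero hr (B.intensity_userFD_top k d t r)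
  filter_upwards [h1, h2] with ω h1 h2
  simp [Link.interference, h1, h2]

end Thresholds

/-! ## The unconditional distribution of the SINR -/

section Distribution

variable {net : Params} {Ω : Type*} [MeasurableSpace Ω] {B : BaseStations net Ω}
  {γ : Fin 2 → ℝ≥0∞} {k : Fin 2} {d : Dir} {Ω' : Type*} [MeasurableSpace Ω']

/-- The conditional coverage probability, given the link length `r`, of a link interfered only by
full-duplex base stations. -/
def BaseStations.coverage (B : BaseStations net Ω) (k : Fin 2) (d : Dir) (r T : ℝ) : ℝ :=
  Real.exp (-T / net.snr (net.sigPower k d) r) * ∏ t, B.laplaceBS k d t r T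

lemma BaseStations.laplaceBS_pos (B : BaseStations net Ω) (k : Fin 2) (d : Dir) (t : Fin 2)
    (r T : ℝ) : 0 < B.laplaceBS k d t r T := by
  cases d <;> exact Real.exp_pos _

lemma BaseStations.laplaceBS_le_one (B : BaseStations net Ω) (k : Fin 2) (d : Dir) (t : Fin 2)
    {r T : ℝ} (hr : 0 < r) (hT : 0 ≤ T) : B.laplaceBS k d t r T ≤ 1 := by
  rw [← ENNReal.ofReal_le_one, ← B.expNeg_lintegral_intensity_bsFD k d t hr hT]
  exact expNeg_le_one _

lemma BaseStations.coverage_nonneg (B : BaseStations net Ω) (k : Fin 2) (d : Dir) (r T : ℝ) :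
    0 ≤ B.coverage k d r T :=
  mul_nonneg (Real.exp_nonneg _) (Finset.prod_nonneg fun t _ => (B.laplaceBS_pos k d t r T).le)

lemma BaseStations.coverage_le (B : BaseStations net Ω) (k : Fin 2) (d : Dir) {r T : ℝ}
    (hr : 0 < r) (hT : 0 ≤ T) :
    B.coverage k d r T ≤ Real.exp (-T / net.snr (net.sigPower k d) r) :=
  mul_le_of_le_one_right (Real.exp_nonneg _) (Finset.prod_le_one
    (fun t _ => (B.laplaceBS_pos k d t r T).le) fun t _ => B.laplaceBS_le_one k d t hr hT)

lemma Params.div_snr (net : Params) (k : Fin 2) (d : Dir) {r : ℝ} (hr : 0 < r) (T : ℝ) :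
    -T / net.snr (net.sigPower k d) r = -(T * r ^ net.α / net.sigPower k d * net.noise) := by
  have := net.sigPower_pos k d
  have := net.noise_pos
  have : 0 < r ^ net.α := Real.rpow_pos_of_pos hr _
  rw [Params.snr, Real.rpow_neg hr.le]
  field_simp

lemma BaseStations.approxC_eq (B : BaseStations net Ω) (k : Fin 2) (d : Dir) (T : ℝ) :
    B.approxC k d T = ∫ r in Set.Ioi 0,
      2 * Real.pi * net.lam k / B.A k * net.F k r * B.coverage k d r T := by
  have : B.approxC k d T = 2 * Real.pi * net.lam k / B.A k * ∫ r in Set.Ioi (0 : ℝ),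
      Real.exp (-T / net.snr (net.sigPower k d) r) * net.F k r * ∏ t, B.laplaceBS k d t r T := by
    cases d <;> rfl
  rw [this, ← integral_const_mul]
  congr 1
  ext r
  rw [BaseStations.coverage]
  ring

/-- If the intensities of the nodes of class `c` are those of the full-duplex base stations at the
thresholds `0`, and no other nodes interfere, the conditional coverage probability is
`coverage`. -/
lemma Link.measure_lt_sinr_eq_coverage (L : Link B γ k d Ω') {r : ℝ} (hr : 0 < r) {c : NodeClass}
    (hint : ∀ t, B.intensity γ k d c t r = B.intensity 0 k d .bsFD t r)
    (hpow : ∀ t, net.txPower c t = net.txPower .bsFD t) {userFD : Bool} {i : Fin 2}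
    (hI : ∀ᵐ ω ∂L.κ r, ∑ t, L.interference userFD i t ω = ∑ t, L.classInterference c t ω)
    {T : ℝ} (hT : 0 ≤ T) :
    L.κ r {ω | T < L.sinr userFD 0 i r ω} = ENNReal.ofReal (B.coverage k d r T) := by
  have hgain : ∀ s t, net.gain s c t = net.gain s .bsFD t := fun s t => by
    ext z; rw [Params.gain, Params.gain, hpow]
  have h0 : 0 ≤ T * r ^ net.α / net.sigPower k d * net.noise := by
    have := net.sigPower_pos k d
    have := net.noise_pos
    positivity
  rw [L.measure_lt_sinr hr c (fun t => ?_) (fun t => B.intensity_zero_singleton _ _ _ _ _ _) hI hT]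
  · simp_rw [hgain, hint, B.expNeg_lintegral_intensity_bsFD k d _ hr hT]
    rw [expNeg_ofReal h0, BaseStations.coverage, net.div_snr k d hr,
      ENNReal.ofReal_mul (Real.exp_nonneg _),
      ENNReal.ofReal_prod_of_nonneg fun t _ => (B.laplaceBS_pos k d t r T).le]
  · rw [hgain, hint]
    exact B.lintegral_intensity_bsFD_ne_top 0 k d t hr

instance (γ : Fin 2 → ℝ≥0∞) (k : Fin 2) : IsFiniteMeasure (B.lawFD γ k) := by
  unfold BaseStations.lawFD
  infer_instance

lemma BaseStations.A_nonneg (B : BaseStations net Ω) (k : Fin 2) : 0 ≤ B.A k := measureReal_nonneg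

/-- The thresholds of the link are left free while the distance law is the one at `0`: the
half-duplex network at `∞` has the same distance law, so both networks are covered. -/
lemma Link.compProd_real_lt_sinr (L : Link B γ k d Ω') {userFD : Bool} {i : Fin 2} {T : ℝ}
    (h : ∀ r, 0 < r → L.κ r {ω | T < L.sinr userFD 0 i r ω} =
      ENNReal.ofReal (B.coverage k d r T)) :
    ((B.lawFD 0 k).compProd L.κ).real {p | T < L.sinr userFD 0 i p.1 p.2} = B.approxC k d T := by
  have hpi := Real.pi_pos
  have hlam := net.lam_pos k
  have hA := B.A_nonneg k
  have hS : MeasurableSet {p : ℝ × Ω' | T < L.sinr userFD 0 i p.1 p.2} :=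
    measurableSet_lt measurable_const (L.measurable_sinr userFD 0 i)
  have hκ : Measurable fun r => L.κ r (Prod.mk r ⁻¹' {p | T < L.sinr userFD 0 i p.1 p.2}) :=
    Kernel.measurable_kernel_prodMk_left hS
  have hF : Measurable fun r => 2 * Real.pi * net.lam k / B.A k * net.F k r :=
    (net.measurable_F k).const_mul _
  have hfun : ∀ r ∈ Set.Ioi (0 : ℝ),
      ENNReal.ofReal (2 * Real.pi * net.lam k / B.A k * net.F k r) *
        L.κ r (Prod.mk r ⁻¹' {p | T < L.sinr userFD 0 i p.1 p.2}) =
      ENNReal.ofReal (2 * Real.pi * net.lam k / B.A k * net.F k r * B.coverage k d r T) := by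
    intro r hr
    have hFr := net.F_nonneg k (le_of_lt hr)
    rw [ENNReal.ofReal_mul (p := 2 * Real.pi * net.lam k / B.A k * net.F k r) (by positivity),
      ← h r hr]
    rfl
  have hlint : ((B.lawFD 0 k).compProd L.κ) {p | T < L.sinr userFD 0 i p.1 p.2} =
      ∫⁻ r in Set.Ioi 0,
        ENNReal.ofReal (2 * Real.pi * net.lam k / B.A k * net.F k r * B.coverage k d r T) := by
    rw [Measure.compProd_apply hS, B.lawFD_zero k,
      lintegral_withDensity_eq_lintegral_mul _ hF.ennreal_ofReal hκ]
    exact setLIntegral_congr_fun measurableSet_Ioi hfun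
  have hmeas : AEStronglyMeasurable
      (fun r => 2 * Real.pi * net.lam k / B.A k * net.F k r * B.coverage k d r T)
      (volume.restrict (Set.Ioi 0)) := by
    -- Measurability of the coverage in `r` is inherited from the kernel, avoiding a study of the
    -- parametric integrals inside it.
    refine AEStronglyMeasurable.congr
      (f := fun r => 2 * Real.pi * net.lam k / B.A k * net.F k r *
        (L.κ r (Prod.mk r ⁻¹' {p | T < L.sinr userFD 0 i p.1 p.2})).toReal)
      (hF.mul hκ.ennreal_toReal).aestronglyMeasurable ?_
    filter_upwards [ae_restrict_mem measurableSet_Ioi] with r hr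
    have : L.κ r (Prod.mk r ⁻¹' {p | T < L.sinr userFD 0 i p.1 p.2}) =
      ENNReal.ofReal (B.coverage k d r T) := h r hr
    rw [this, ENNReal.toReal_ofReal (B.coverage_nonneg k d r T)]
  rw [Measure.real, hlint, B.approxC_eq, integral_eq_lintegral_of_nonneg_ae _ hmeas]
  filter_upwards [ae_restrict_mem measurableSet_Ioi] with r hr
  have hFr := net.F_nonneg k (le_of_lt hr)
  have := B.coverage_nonneg k d r T
  change 0 ≤ _
  positivity

lemma exp_neg_le_rpow {a u : ℝ} (ha0 : 0 ≤ a) (ha1 : a ≤ 1) (hu : 0 < u) :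
    Real.exp (-u) ≤ u ^ (-a) := by
  rw [Real.exp_neg, Real.rpow_neg hu.le]
  refine inv_anti₀ (Real.rpow_pos_of_pos hu _) ?_
  calc u ^ a ≤ (u + 1) ^ a := Real.rpow_le_rpow hu.le (by linarith) ha0
    _ ≤ (u + 1) ^ (1 : ℝ) := Real.rpow_le_rpow_of_exponent_le (by linarith) ha1
    _ = u + 1 := Real.rpow_one _
    _ ≤ Real.exp u := Real.add_one_le_exp u

lemma BaseStations.approxC_nonneg (B : BaseStations net Ω) (k : Fin 2) (d : Dir) (T : ℝ) :
    0 ≤ B.approxC k d T := by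
  have hpi := Real.pi_pos
  have hlam := net.lam_pos k
  have hA := B.A_nonneg k
  rw [B.approxC_eq]
  refine setIntegral_nonneg measurableSet_Ioi fun r hr => ?_
  have hFr := net.F_nonneg k (le_of_lt hr)
  have := B.coverage_nonneg k d r T
  positivity

/-- Only the noise factor is kept: with `q = σ² / p`, `exp (-q T r ^ α) ≤ (q T r ^ α) ^ (-1/α) = (q
T) ^ (-1/α) / r`. The exponent `1/α` is chosen so that `1 / r` cancels the factor `r` of `F`,
leaving a Gaussian integral. -/
lemma BaseStations.exists_approxC_le (B : BaseStations net Ω) (k : Fin 2) (d : Dir) :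
    ∃ K, ∀ T, 0 < T → B.approxC k d T ≤ K * T ^ (-(1 / net.α)) := by
  have hpi := Real.pi_pos
  have hlam := net.lam_pos k
  have hlam' := net.lam_pos k.rev
  have hA := B.A_nonneg k
  have hα := net.two_lt_α
  have hα0 : net.α ≠ 0 := by linarith
  have hp := net.sigPower_pos k d
  have hN := net.noise_pos
  have hβ0 : 0 ≤ 1 / net.α := by positivity
  have hβ1 : 1 / net.α ≤ 1 := by rw [div_le_one] <;> linarith
  set q := net.noise / net.sigPower k d with hq
  have hq0 : 0 < q := by positivity
  set C := 2 * Real.pi * net.lam k / B.A k with hC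
  have hC0 : 0 ≤ C := by positivity
  have hgauss : Integrable fun r : ℝ => Real.exp (-(Real.pi * net.lam k) * r ^ 2) :=
    integrable_exp_neg_mul_sq (by positivity)
  refine ⟨C * q ^ (-(1 / net.α)) * ∫ r in Set.Ioi (0 : ℝ),
    Real.exp (-(Real.pi * net.lam k) * r ^ 2), fun T hT => ?_⟩
  have hrw : C * q ^ (-(1 / net.α)) * (∫ r in Set.Ioi (0 : ℝ),
      Real.exp (-(Real.pi * net.lam k) * r ^ 2)) * T ^ (-(1 / net.α)) =
      ∫ r in Set.Ioi (0 : ℝ), C * q ^ (-(1 / net.α)) * T ^ (-(1 / net.α)) *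
        Real.exp (-(Real.pi * net.lam k) * r ^ 2) := by
    rw [integral_const_mul]; ring
  rw [hrw, B.approxC_eq]
  refine integral_mono_of_nonneg ?_ (hgauss.restrict.const_mul _) ?_
  · filter_upwards [ae_restrict_mem measurableSet_Ioi] with r hr
    have hFr := net.F_nonneg k (le_of_lt hr)
    have := B.coverage_nonneg k d r T
    change 0 ≤ _
    positivity
  · filter_upwards [ae_restrict_mem measurableSet_Ioi] with r hr
    have hr0 : (0 : ℝ) < r := hr
    have hra : 0 < r ^ net.α := Real.rpow_pos_of_pos hr0 _
    have hFr := net.F_nonneg k hr0.le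
    have hF : net.F k r ≤ r * Real.exp (-(Real.pi * net.lam k) * r ^ 2) := by
      refine mul_le_mul_of_nonneg_left (Real.exp_le_exp.2 ?_) hr0.le
      have : 0 ≤ Real.pi * net.lam k.rev * net.mu k r ^ 2 := by positivity
      linarith
    have hcov : B.coverage k d r T ≤ q ^ (-(1 / net.α)) * T ^ (-(1 / net.α)) * r⁻¹ := by
      refine (B.coverage_le k d hr0 hT.le).trans ?_
      rw [net.div_snr k d hr0]
      have harg : T * r ^ net.α / net.sigPower k d * net.noise = q * T * r ^ net.α := by
        rw [hq]; ring
      rw [harg]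
      refine (exp_neg_le_rpow hβ0 hβ1 (by positivity)).trans (le_of_eq ?_)
      rw [Real.mul_rpow (by positivity) hra.le, Real.mul_rpow hq0.le hT.le, ← Real.rpow_mul hr0.le,
        mul_neg, mul_one_div_cancel hα0, Real.rpow_neg_one]
    have hcov0 := B.coverage_nonneg k d r T
    calc C * net.F k r * B.coverage k d r T
        ≤ C * (r * Real.exp (-(Real.pi * net.lam k) * r ^ 2)) *
          (q ^ (-(1 / net.α)) * T ^ (-(1 / net.α)) * r⁻¹) := by
          refine mul_le_mul (mul_le_mul_of_nonneg_left hF hC0) hcov hcov0 (by positivity)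
      _ = _ := by field_simp

/-- Compare with `T ^ (-b)` on `(0, 1]`, using `b < 1`, and with `T ^ (-b - 1)` beyond, using `b >
0`. -/
lemma integrableOn_rpow_div_one_add {b : ℝ} (hb0 : 0 < b) (hb1 : b < 1) :
    IntegrableOn (fun T : ℝ => T ^ (-b) / (1 + T)) (Set.Ioi 0) := by
  have hm : AEStronglyMeasurable (fun T : ℝ => T ^ (-b) / (1 + T)) volume := by
    have : Measurable fun T : ℝ => T ^ (-b) / (1 + T) := by fun_prop
    exact this.aestronglyMeasurable
  rw [← Set.Ioc_union_Ioi_eq_Ioi zero_le_one]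
  refine IntegrableOn.union ?_ ?_
  · have h1 : IntegrableOn (fun T : ℝ => T ^ (-b)) (Set.Ioc 0 1) :=
      (intervalIntegrable_iff_integrableOn_Ioc_of_le zero_le_one).1
        (intervalIntegral.intervalIntegrable_rpow' (by linarith))
    refine Integrable.mono' h1 hm.restrict ?_
    filter_upwards [ae_restrict_mem measurableSet_Ioc] with T hT
    have h0 : 0 ≤ T ^ (-b) := Real.rpow_nonneg hT.1.le _
    rw [Real.norm_of_nonneg (div_nonneg h0 (by linarith [hT.1]))]
    exact div_le_self h0 (by linarith [hT.1])
  · refine Integrable.mono' (integrableOn_Ioi_rpow_of_lt (a := -b - 1) (by linarith) one_pos)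
      hm.restrict ?_
    filter_upwards [ae_restrict_mem measurableSet_Ioi] with T hT
    have hT0 : (0 : ℝ) < T := one_pos.trans hT
    have h0 : 0 ≤ T ^ (-b) := Real.rpow_nonneg hT0.le _
    rw [Real.norm_of_nonneg (div_nonneg h0 (by linarith)), Real.rpow_sub hT0, Real.rpow_one]
    exact div_le_div_of_nonneg_left h0 hT0 (by linarith)

lemma BaseStations.integrableOn_approxC (B : BaseStations net Ω) {k : Fin 2} {d : Dir}
    {X : Type*} [MeasurableSpace X] {m : Measure X} [IsFiniteMeasure m] {θ : X → ℝ}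
    (hC : ∀ T, 0 ≤ T → m.real {p | T < θ p} = B.approxC k d T) :
    IntegrableOn (fun T : ℝ => B.approxC k d T / (1 + T)) (Set.Ioi 0) := by
  obtain ⟨K, hK⟩ := B.exists_approxC_le k d
  have hα := net.two_lt_α
  -- Realising the closed form as the tail of some `θ` serves only to make it measurable in `T`, by
  -- monotonicity.
  have hanti : Antitone fun T : ℝ => m.real {p | T < θ p} := fun T T' h =>
    measureReal_mono fun p hp => lt_of_le_of_lt h hp
  have hmeas : AEStronglyMeasurable (fun T : ℝ => B.approxC k d T / (1 + T))
      (volume.restrict (Set.Ioi 0)) := by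
    refine AEStronglyMeasurable.congr (f := fun T : ℝ => m.real {p | T < θ p} / (1 + T))
      (hanti.measurable.div (measurable_const.add measurable_id)).aestronglyMeasurable ?_
    filter_upwards [ae_restrict_mem measurableSet_Ioi] with T hT
    rw [hC T (le_of_lt hT)]
  refine Integrable.mono' ((integrableOn_rpow_div_one_add (b := 1 / net.α) (by positivity)
    (by rw [div_lt_one] <;> linarith)).const_mul K) hmeas ?_
  filter_upwards [ae_restrict_mem measurableSet_Ioi] with T hT
  have hT0 : (0 : ℝ) < T := hT
  rw [Real.norm_of_nonneg (div_nonneg (B.approxC_nonneg k d T) (by linarith)), ← mul_div_assoc]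
  exact div_le_div_of_nonneg_right (hK T hT0) (by linarith)

end Distribution

/-- The mean of `log₂ (1 + θ)` in terms of the tail of `θ`. -/
lemma integral_logb_one_add {X : Type*} [MeasurableSpace X] {m : Measure X} [IsFiniteMeasure m]
    {θ : X → ℝ} (hθ : Measurable θ) (hθ0 : ∀ p, 0 ≤ θ p) {C : ℝ → ℝ}
    (hC : ∀ T, 0 ≤ T → m.real {p | T < θ p} = C T)
    (hint : IntegrableOn (fun T => C T / (1 + T)) (Set.Ioi 0)) :
    Integrable (fun p => Real.logb 2 (1 + θ p)) m ∧
      ∫ p, Real.logb 2 (1 + θ p) ∂m =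
        1 / Real.log 2 * ∫ T in Set.Ioi (0 : ℝ), C T / (1 + T) := by
  have hlogint : ∀ x : ℝ, 0 ≤ x → ∫ t in (0 : ℝ)..x, (1 + t)⁻¹ = Real.log (1 + x) := by
    intro x hx
    have h := intervalIntegral.integral_comp_add_left (fun t : ℝ => t⁻¹) (1 : ℝ) (a := 0) (b := x)
    rw [h, integral_inv_of_pos (by norm_num) (by linarith)]
    simp
  have hgi : ∀ t > 0, IntervalIntegrable (fun t : ℝ => (1 + t)⁻¹) volume 0 t := by
    intro t ht
    refine ContinuousOn.intervalIntegrable fun x hx => ContinuousAt.continuousWithinAt ?_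
    rw [Set.uIcc_of_le ht.le] at hx
    have : (1 : ℝ) + x ≠ 0 := by linarith [hx.1]
    fun_prop (disch := assumption)
  have hCnn : ∀ T ∈ Set.Ioi (0 : ℝ), 0 ≤ C T / (1 + T) := fun T hT => by
    have hT0 : (0 : ℝ) < T := hT
    rw [← hC T hT0.le]
    exact div_nonneg measureReal_nonneg (by linarith)
  -- Layer-cake formula with weight `1 / (1 + t)`, whose primitive vanishing at `0` is `log (1 +
  -- x)`.
  have hlayer := lintegral_comp_eq_lintegral_meas_lt_mul m (f := θ) (g := fun t => (1 + t)⁻¹)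
    (ae_of_all _ hθ0) hθ.aemeasurable hgi (by
      filter_upwards [ae_restrict_mem measurableSet_Ioi] with t ht
      exact inv_nonneg.2 (by linarith [Set.mem_Ioi.1 ht]))
  have hrhs : ∫⁻ t in Set.Ioi 0, m {a | t < θ a} * ENNReal.ofReal (1 + t)⁻¹ =
      ENNReal.ofReal (∫ T in Set.Ioi (0 : ℝ), C T / (1 + T)) := by
    rw [ofReal_integral_eq_lintegral_ofReal hint
      ((ae_restrict_iff' measurableSet_Ioi).2 (ae_of_all _ hCnn))]
    refine setLIntegral_congr_fun measurableSet_Ioi fun T hT => ?_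
    have hT0 : (0 : ℝ) < T := hT
    rw [div_eq_mul_inv, ← hC T hT0.le, ENNReal.ofReal_mul measureReal_nonneg, ofReal_measureReal]
  have hlog : ∫⁻ p, ENNReal.ofReal (Real.log (1 + θ p)) ∂m =
      ENNReal.ofReal (∫ T in Set.Ioi (0 : ℝ), C T / (1 + T)) := by
    rw [← hrhs, ← hlayer]
    exact lintegral_congr fun p => by rw [hlogint _ (hθ0 p)]
  have hlognn : ∀ p, 0 ≤ Real.log (1 + θ p) := fun p => Real.log_nonneg (by linarith [hθ0 p])
  have hlogm : Measurable fun p => Real.log (1 + θ p) := (measurable_const.add hθ).log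
  have hlogi : Integrable (fun p => Real.log (1 + θ p)) m := by
    refine ⟨hlogm.aestronglyMeasurable, ?_⟩
    rw [hasFiniteIntegral_iff_ofReal (ae_of_all _ hlognn), hlog]
    exact ENNReal.ofReal_lt_top
  have hint' : ∫ p, Real.log (1 + θ p) ∂m = ∫ T in Set.Ioi (0 : ℝ), C T / (1 + T) := by
    rw [integral_eq_lintegral_of_nonneg_ae (ae_of_all _ hlognn) hlogm.aestronglyMeasurable, hlog,
      ENNReal.toReal_ofReal (setIntegral_nonneg measurableSet_Ioi hCnn)]
  refine ⟨hlogi.div_const _, ?_⟩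
  rw [← hint']
  unfold Real.logb
  rw [integral_div]
  ring

/-! ## Full-duplex and half-duplex networks -/

section Networks

variable {net : Params} {Ω : Type*} [MeasurableSpace Ω] {B : BaseStations net Ω}
  {k : Fin 2} {d : Dir} {Ω' : Type*} [MeasurableSpace Ω']

instance (γ : Fin 2 → ℝ≥0∞) (L : Link B γ k d Ω') : IsFiniteMeasure L.jointFD := by
  unfold Link.jointFD
  infer_instance

lemma Link.sinrFD_zero (L : Link B 0 k d Ω') (userFD : Bool) (i : Fin 2) (p : ℝ × Ω') :
    L.sinrFD userFD Residual.zero i p = L.sinr userFD 0 i p.1 p.2 := by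
  cases d <;> rfl

lemma Link.distFD_eq_approxC (L : Link B 0 k d Ω') (i : Fin 2) {T : ℝ} (hT : 0 ≤ T) :
    L.distFD false Residual.zero i T = B.approxC k d T := by
  simp only [Link.distFD, Link.sinrFD_zero]
  exact L.compProd_real_lt_sinr fun r hr => L.measure_lt_sinr_eq_coverage hr
    (c := .bsFD) (fun _ => rfl) (fun _ => rfl) (L.ae_interference_zero hr i) hT

lemma Link.integrableOn_approxC (L : Link B 0 k d Ω') :
    IntegrableOn (fun T : ℝ => B.approxC k d T / (1 + T)) (Set.Ioi 0) :=
  B.integrableOn_approxC (m := L.jointFD) fun _ hT => L.distFD_eq_approxC 0 hT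

lemma Link.integral_logb_sinrFD (L : Link B 0 k d Ω') (i : Fin 2) :
    Integrable (fun p => Real.logb 2 (1 + L.sinrFD false Residual.zero i p)) L.jointFD ∧
      ∫ p, Real.logb 2 (1 + L.sinrFD false Residual.zero i p) ∂L.jointFD =
        1 / Real.log 2 * ∫ T in Set.Ioi (0 : ℝ), B.approxC k d T / (1 + T) := by
  refine integral_logb_one_add (θ := L.sinrFD false Residual.zero i) ?_
    (fun p => ENNReal.toReal_nonneg) (fun T hT => L.distFD_eq_approxC i hT) L.integrableOn_approxC
  rw [show L.sinrFD false Residual.zero i = fun p => L.sinr false 0 i p.1 p.2 from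
    funext (L.sinrFD_zero false i)]
  exact L.measurable_sinr false 0 i

lemma Link.SFD_eq (L : Link B 0 k d Ω') (i : Fin 2) :
    L.SFD false Residual.zero i =
      1 / 2 * (1 / Real.log 2 * ∫ T in Set.Ioi (0 : ℝ), B.approxC k d T / (1 + T)) := by
  rw [Link.SFD, (L.integral_logb_sinrFD i).2]

/-- The value is that of a full-duplex downlink at the thresholds `0`. Keeping the full-duplex users
costs nothing, since that class is empty at the thresholds `∞`. -/
lemma Link.SHD_eq (L : Link B ⊤ k .down Ω') :
    L.SHD true 0 =
      1 / 2 * (1 / Real.log 2 * ∫ T in Set.Ioi (0 : ℝ), B.approxC k .down T / (1 + T)) := by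
  have hjoint : L.jointHD = (B.lawFD 0 k).compProd L.κ := by rw [Link.jointHD, B.lawHD_top]
  have hC : ∀ T, 0 ≤ T → L.jointHD.real {p | T < L.sinrHD true 0 p} = B.approxC k .down T := by
    intro T hT
    rw [hjoint]
    exact L.compProd_real_lt_sinr fun r hr => L.measure_lt_sinr_eq_coverage hr
      (c := .bsHD) (fun t => B.intensity_bsHD_top k t r) (fun _ => rfl) (L.ae_interference_top hr) hT
  have : IsFiniteMeasure L.jointHD := by rw [hjoint]; infer_instance
  rw [Link.SHD, (integral_logb_one_add (θ := L.sinrHD true 0) (L.measurable_sinr true 0 0)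
    (fun p => L.sinr_nonneg true 0 0 p.1 p.2) hC (B.integrableOn_approxC hC)).2]

end Networks

end HetNet

end

/-- Full-duplex network: thresholds `0`, perfect self-interference cancellation (`Residual.zero`),
interference from full-duplex users neglected (`false`). It is compared with the half-duplex network
with thresholds `∞`, without any such approximation. -/
theorem corollary4 {Ω₀ Ω₁ Ω₂ : Type*} [MeasurableSpace Ω₀] [MeasurableSpace Ω₁] [MeasurableSpace Ω₂]
    (net : HetNet.Params) (B : HetNet.BaseStations net Ω₀)
    (fd : ∀ (k : Fin 2) (d : HetNet.Dir), HetNet.Link B 0 k d Ω₁)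
    (hd : ∀ (k : Fin 2) (d : HetNet.Dir), HetNet.Link B ⊤ k d Ω₂)
    (ρ : HetNet.Residual) :
    -- the closed forms are the SINR distributions, on both channels
    (∀ (k : Fin 2) (d : HetNet.Dir) (i : Fin 2) (T : ℝ), 0 ≤ T →
      (fd k d).distFD false HetNet.Residual.zero i T = B.approxC k d T) ∧
    -- the expectations and integrals below are finite
    (∀ (k : Fin 2) (d : HetNet.Dir) (i : Fin 2),
      Integrable (fun p => Real.logb 2 (1 + (fd k d).sinrFD false HetNet.Residual.zero i p))
        (fd k d).jointFD) ∧
    (∀ k : Fin 2, IntegrableOn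
      (fun T : ℝ => (B.approxC k .down T + B.approxC k .up T) / (1 + T)) (Set.Ioi 0)) ∧
    -- the spectral efficiency of the full-duplex network
    HetNet.spectralEfficiency fd false HetNet.Residual.zero =
      1 / Real.log 2 * ∑ k : Fin 2, B.A k *
        ∫ T in Set.Ioi (0 : ℝ), (B.approxC k .down T + B.approxC k .up T) / (1 + T) ∧
    -- its downlink part is twice that of the half-duplex network
    HetNet.downlinkSpectralEfficiency fd false HetNet.Residual.zero =
      2 * HetNet.downlinkSpectralEfficiency hd true ρ := by
  have hint : ∀ k d, IntegrableOn (fun T : ℝ => B.approxC k d T / (1 + T)) (Set.Ioi 0) :=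
    fun k d => (fd k d).integrableOn_approxC
  refine ⟨fun k d i T hT => (fd k d).distFD_eq_approxC i hT,
    fun k d i => ((fd k d).integral_logb_sinrFD i).1, fun k => ?_, ?_, ?_⟩
  · simp_rw [add_div]
    exact (hint k .down).add (hint k .up)
  · have hadd : ∀ k, ∫ T in Set.Ioi (0 : ℝ), (B.approxC k .down T + B.approxC k .up T) / (1 + T) =
        (∫ T in Set.Ioi (0 : ℝ), B.approxC k .down T / (1 + T)) +
          ∫ T in Set.Ioi (0 : ℝ), B.approxC k .up T / (1 + T) := fun k => by
      simp_rw [add_div]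
      exact integral_add (hint k .down) (hint k .up)
    -- Half-duplex terms carry the weight `0`, and the two equal channels cancel the prefactor
    -- `1/2`.
    simp only [HetNet.spectralEfficiency, HetNet.Link.SFD_eq, B.AFD_zero, B.AHD_zero, hadd,
      Fin.sum_univ_two]
    ring
  -- The residual `ρ` enters only terms weighted by `A_k^FD = 0`. What remains is two channels
  -- against one, with equal weights `A_k` and equal values.
  · simp only [HetNet.downlinkSpectralEfficiency, HetNet.Link.SFD_eq, HetNet.Link.SHD_eq,
      B.AFD_zero, B.AHD_zero, B.AFD_top, B.AHD_top, Fin.sum_univ_two]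
    ring
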